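/- For a continuous function $F:[a,b]\to\mathbb R$ and $x\in[a,b]$, the right and left Laplace derivatives of $F$ at $x$ are the limits $$LD_1^+F(x)=\lim_{s\to\infty}s^2\int_0^\delta e^{-st}[F(x+t)-F(x)]\,dt\quad(x<b),\qquad LD_1^-F(x)=\lim_{s\to\infty}(-s^2)\int_0^\delta e^{-st}[F(x-t)-F(x)]\,dt\quad(x>a),$$ where $\delta>0$ is such that the integrand is defined (the limits do not depend on $\delta$). $F$ is Laplace differentiable at $x$, with Laplace derivative $LD_1F(x)$, if both exist in $\mathbb R$ and agree (at an endpoint: if the one that makes sense exists). The lower derivate $\underline{LD}_1F(x)\in[-\infty,\infty]$ is the smaller of the two corresponding lower limits (at an endpoint: the one that makes sense). A major function of $\varphi:[a,b]\to\mathbb R$ is a continuous $U:[a,b]\to\mathbb R$ with $\underline{LD}_1U\ge \varphi$ and $\underline{LD}_1U>-\infty$ on $[a,b]$; $V$ is a minor function of $\varphi$ if $-V$ is a major function of $-\varphi$. The function $\varphi$ is Laplace integrable on $[a,b]$ if $\sup_V (V(b)-V(a))$ over the minor functions and $\inf_U (U(b)-U(a))$ over the major functions are equal and finite; the common value is its Laplace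 integral. The Perron integral is defined in the same way, with the ordinary lower derivate $\underline DU$ in place of $\underline{LD}_1U$ (major and minor functions being continuous). Let $S=\mathrm{SVC}(4)=\bigcap_n S_n$, where $S_0=[0,1]$ and $S_n$ arises from $S_{n-1}$ by removing from the middle of each component interval of $S_{n-1}$ an open interval of length $4^{-n}$. Let $(a_n,b_n)$, $n\in\mathbb N$, be an enumeration of all the removed intervals and $c_n=(a_n+b_n)/2$. Define $f:[0,1]\to\mathbb R$ by $f=0$ on $S$ and $$f(x)=(x-a_n)^{1/4}\sin\big((x-a_n)^{-7/4}\big)\ \ (a_n<x\le c_n),\qquad f(x)=(b_n-x)^{1/4}\sin\big((b_n-x)^{-7/4}\big)\ \ (c_n\le x<b_n).$$ Theorem. (1) $f$ is continuous on $[0,1]$; $LD_1^+f$ exists finitely on $[0,1)$ and $LD_1^-f$ exists finitely on $(0,1]$; and $f$ is Laplace differentiable at every point of $[0,1]$ other than the midpoints $c_n$ (in particular at every point of $S$). (2) $f$ is not differentiable at any point of $S$. (3) Every function $\varphi:[0,1]\to\mathbb R$ with $\varphi=LD_1f$ on $[0,1]\setminus\{c_n: n\in\mathbb N\}$ is Laplace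 integrable on $[0,1]$ but not Perron integrable on $[0,1]$. (4) For all $a<b$, every function that is Perron integrable on $[a,b]$ is Laplace integrable on $[a,b]$ with the same integral, and the set of Perron integrable functions on $[0,1]$ is a proper subset of the set of Laplace integrable functions on $[0,1]$. -/

import Mathlib

open Set Filter Topology MeasureTheory

noncomputable section

/-! ### The Laplace derivative of a function on a compact interval

All functions are total functions `ℝ → ℝ`; a function on `[a, b]` enters only through its values
on `[a, b]`, and at the endpoints `a`, `b` only the one-sided limit that lives in `[a, b]` is used.
The derivatives are applied to functions that are continuous on `[a, b]` only, so that the integrals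
below are ordinary (Lebesgue, equivalently Riemann or Perron) integrals. -/

/-- `s² ∫₀^δ e^{-st} [F(x+t) - F(x)] dt`. -/
def laplaceQuotRight (F : ℝ → ℝ) (x δ s : ℝ) : ℝ :=
  s ^ 2 * ∫ t in (0 : ℝ)..δ, Real.exp (-(s * t)) * (F (x + t) - F x)

/-- `(-s²) ∫₀^δ e^{-st} [F(x-t) - F(x)] dt`. -/
def laplaceQuotLeft (F : ℝ → ℝ) (x δ s : ℝ) : ℝ :=
  -s ^ 2 * ∫ t in (0 : ℝ)..δ, Real.exp (-(s * t)) * (F (x - t) - F x)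

/-- The right Laplace derivative at `x` of a function given up to the right endpoint `b` exists
and is the real number `L`. -/
def HasRightLaplaceDeriv (F : ℝ → ℝ) (b L x : ℝ) : Prop :=
  ∃ δ : ℝ, 0 < δ ∧ x + δ ≤ b ∧ IntervalIntegrable F volume x (x + δ) ∧
    Tendsto (fun s : ℝ => laplaceQuotRight F x δ s) atTop (𝓝 L)

/-- The left Laplace derivative at `x` of a function given from the left endpoint `a` on exists
and is the real number `L`. -/
def HasLeftLaplaceDeriv (F : ℝ → ℝ) (a L x : ℝ) : Prop :=
  ∃ δ : ℝ, 0 < δ ∧ a ≤ x - δ ∧ IntervalIntegrable F volume (x - δ) x ∧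
    Tendsto (fun s : ℝ => laplaceQuotLeft F x δ s) atTop (𝓝 L)

/-- The Laplace derivative `LD₁ F (x)` of `F : [a, b] → ℝ` at `x ∈ [a, b]` exists and is the real
number `L`: both one-sided limits equal `L` (at an endpoint: the one that makes sense). The limits do
not depend on `δ`, so it is immaterial whether one `δ` serves both sides. -/
def HasLaplaceDeriv (F : ℝ → ℝ) (a b L x : ℝ) : Prop :=
  (x < b → HasRightLaplaceDeriv F b L x) ∧ (a < x → HasLeftLaplaceDeriv F a L x)

open Classical in
/-- The lower Laplace derivate of `F : [a, b] → ℝ` at `x ∈ [a, b]`, in `[-∞, ∞]`: the smaller of the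
two one-sided lower limits (at an endpoint: the one that makes sense). As these do not depend on `δ`,
the largest possible `δ` is used. -/
def lowerLaplaceDeriv (F : ℝ → ℝ) (a b x : ℝ) : EReal :=
  (if x < b then liminf (fun s : ℝ => ((laplaceQuotRight F x (b - x) s : ℝ) : EReal)) atTop
    else ⊤) ⊓
  (if a < x then liminf (fun s : ℝ => ((laplaceQuotLeft F x (x - a) s : ℝ) : EReal)) atTop
    else ⊤)

/-! ### The Laplace integral -/

/-- `U` is a major function of `f` on `[a, b]`, in the sense of the Laplace integral. -/
def IsLaplaceMajor (f : ℝ → ℝ) (a b : ℝ) (U : ℝ → ℝ) : Prop :=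
  ContinuousOn U (Icc a b) ∧
    ∀ x ∈ Icc a b, (f x : EReal) ≤ lowerLaplaceDeriv U a b x ∧ ⊥ < lowerLaplaceDeriv U a b x

/-- `V` is a minor function of `f` on `[a, b]`: `-V` is a major function of `-f`. -/
def IsLaplaceMinor (f : ℝ → ℝ) (a b : ℝ) (V : ℝ → ℝ) : Prop :=
  IsLaplaceMajor (fun x => -f x) a b (fun x => -V x)

/-- `f` is Laplace integrable on `[a, b]` with integral `I`. The bounds are taken in `[-∞, ∞]`. -/
def HasLaplaceIntegral (f : ℝ → ℝ) (a b I : ℝ) : Prop :=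
  sSup {r : EReal | ∃ V, IsLaplaceMinor f a b V ∧ r = ((V b - V a : ℝ) : EReal)} = (I : EReal) ∧
  sInf {r : EReal | ∃ U, IsLaplaceMajor f a b U ∧ r = ((U b - U a : ℝ) : EReal)} = (I : EReal)

/-- `f` is Laplace integrable on `[a, b]`. -/
def LaplaceIntegrable (f : ℝ → ℝ) (a b : ℝ) : Prop := ∃ I : ℝ, HasLaplaceIntegral f a b I

/-! ### The Perron integral -/

/-- The lower derivate of `F : [a, b] → ℝ` at `x ∈ [a, b]`, in `[-∞, ∞]`. -/
def lowerDerivate (F : ℝ → ℝ) (a b x : ℝ) : EReal :=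
  liminf (fun y : ℝ => (((F y - F x) / (y - x) : ℝ) : EReal)) (𝓝[Icc a b \ {x}] x)

/-- `U` is a (continuous) major function of `f` on `[a, b]`, in the sense of the Perron integral. -/
def IsPerronMajor (f : ℝ → ℝ) (a b : ℝ) (U : ℝ → ℝ) : Prop :=
  ContinuousOn U (Icc a b) ∧
    ∀ x ∈ Icc a b, (f x : EReal) ≤ lowerDerivate U a b x ∧ ⊥ < lowerDerivate U a b x

/-- `V` is a minor function of `f` on `[a, b]`: `-V` is a major function of `-f`. -/
def IsPerronMinor (f : ℝ → ℝ) (a b : ℝ) (V : ℝ → ℝ) : Prop :=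
  IsPerronMajor (fun x => -f x) a b (fun x => -V x)

/-- `f` is Perron integrable on `[a, b]` with integral `I`. The bounds are taken in `[-∞, ∞]`. -/
def HasPerronIntegral (f : ℝ → ℝ) (a b I : ℝ) : Prop :=
  sSup {r : EReal | ∃ V, IsPerronMinor f a b V ∧ r = ((V b - V a : ℝ) : EReal)} = (I : EReal) ∧
  sInf {r : EReal | ∃ U, IsPerronMajor f a b U ∧ r = ((U b - U a : ℝ) : EReal)} = (I : EReal)

/-- `f` is Perron integrable on `[a, b]`. -/
def PerronIntegrable (f : ℝ → ℝ) (a b : ℝ) : Prop := ∃ I : ℝ, HasPerronIntegral f a b I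

/-! ### The Smith-Volterra-Cantor set SVC(4) and the function on it -/

/-- The left endpoint of the open interval of length `1 / 4 ^ (n + 1)` removed from the middle of a
component interval `[q.1, q.2]` of the `n`-th stage. -/
def svcCutLeft (n : ℕ) (q : ℝ × ℝ) : ℝ := (q.1 + q.2) / 2 - 1 / 2 ^ (2 * (n + 1) + 1)

/-- The right endpoint of that interval. -/
def svcCutRight (n : ℕ) (q : ℝ × ℝ) : ℝ := (q.1 + q.2) / 2 + 1 / 2 ^ (2 * (n + 1) + 1)

/-- The component intervals `[p.1, p.2]` of the `n`-th stage, as pairs of endpoints. -/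
def svcComponents : ℕ → Set (ℝ × ℝ)
  | 0 => {((0 : ℝ), (1 : ℝ))}
  | n + 1 => {p | ∃ q ∈ svcComponents n, p = (q.1, svcCutLeft n q) ∨ p = (svcCutRight n q, q.2)}

/-- The `n`-th stage `Sₙ` of the construction. -/
def svcStage (n : ℕ) : Set ℝ := ⋃ p ∈ svcComponents n, Icc p.1 p.2

/-- The Smith-Volterra-Cantor set SVC(4). -/
def SVC4 : Set ℝ := ⋂ n : ℕ, svcStage n

/-- The contiguous intervals `(p.1, p.2)` of SVC(4) in `[0, 1]`: all the removed intervals. -/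
def svcGaps : Set (ℝ × ℝ) :=
  {p | ∃ n : ℕ, ∃ q ∈ svcComponents n, p = (svcCutLeft n q, svcCutRight n q)}

/-- The midpoints of the contiguous intervals. -/
def svcMidpoints : Set ℝ := {c | ∃ p ∈ svcGaps, c = (p.1 + p.2) / 2}

/-- The piece on a contiguous interval `(α, β)`: `(x-α)^{1/4} sin ((x-α)^{-7/4})` on the left half,
`(β-x)^{1/4} sin ((β-x)^{-7/4})` on the right half. -/
def gapPiece (α β x : ℝ) : ℝ :=
  if x ≤ (α + β) / 2 then (x - α) ^ (1 / 4 : ℝ) * Real.sin ((x - α) ^ (-(7 / 4) : ℝ))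
  else (β - x) ^ (1 / 4 : ℝ) * Real.sin ((β - x) ^ (-(7 / 4) : ℝ))

open Classical in
/-- The function `f` that is `gapPiece` on each contiguous interval (these are pairwise disjoint) and
`0` on SVC(4). -/
def svcFun (x : ℝ) : ℝ :=
  if h : ∃ p ∈ svcGaps, x ∈ Ioo p.1 p.2 then gapPiece h.choose.1 h.choose.2 x else 0

end

/-! The Laplace quotient averages the increments of `F` against a positive kernel, so cancellation
in an oscillating increment counts, whereas an ordinary difference quotient sees only its size. The
exponents 1/4 and -7/4 exploit this. Since `(4/7) u^3 cos(u^(-7/4))` has derivative `u^(1/4)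
sin(u^(-7/4))` up to a term of order `u^2`, the integral of the oscillation over `[0, h]` is
`O(h^3)` (`abs_integral_chirp_le`). Cubes of disjoint overlaps add up to at most the cube of the
total length, so at a point outside all gaps the whole function has a cubically small primitive
(`abs_integral_svcFun_le`). One integration by parts then gives Laplace derivative 0 there
(`tendsto_laplaceMean_zero_of_primitive_le`). Inside a gap `f` has ordinary derivatives, merely
one-sided at the midpoint.

At a point of the Cantor set the amplitude wins instead. Within distance `2^(-n)` there is a gap of
length `4^(-(n+1))`, where `f` reaches both signs of a value of order `4^(-n/4)`. This makes
difference quotients of order `-2^(n/2)`, so the lower derivate is `-∞`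
(`frequently_svcFun_quotient_lt`).

For integrability, a maximum argument shows that a continuous function with nonnegative lower right
Laplace derivates is nondecreasing; hence every minor increment is at most every major increment.
The midpoints are countable, so there is a bounded increasing `G` with infinite derivative at each
of them, and `f ± εG` are major and minor functions whose increments pinch `f(1) - f(0)`. If a
Perron major function `U` existed, `U + G - f` would be monotone, hence differentiable almost
everywhere, and `f` would have lower derivate above `-∞` almost everywhere. That contradicts the
positive measure of the Cantor set. The Perron integral is contained in the Laplace integral because
averaging preserves linear lower bounds (`lowerDerivate_le_lowerLaplaceDeriv`). -/

/-! ### Laplace means -/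

/-- `s² ∫₀^δ e^{-st} g(t) dt`. -/
noncomputable def laplaceMean (g : ℝ → ℝ) (δ s : ℝ) : ℝ :=
  s ^ 2 * ∫ t in (0 : ℝ)..δ, Real.exp (-(s * t)) * g t

theorem laplaceQuotRight_eq_mean (F : ℝ → ℝ) (x δ s : ℝ) :
    laplaceQuotRight F x δ s = laplaceMean (fun t => F (x + t) - F x) δ s := rfl

theorem laplaceQuotLeft_eq_mean (F : ℝ → ℝ) (x δ s : ℝ) :
    laplaceQuotLeft F x δ s = laplaceMean (fun t => F x - F (x - t)) δ s := by
  unfold laplaceQuotLeft laplaceMean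
  rw [neg_mul, ← mul_neg, ← intervalIntegral.integral_neg]
  congr 2
  ext t
  ring

theorem tendsto_pow_mul_exp_neg_mul (n : ℕ) {δ : ℝ} (hδ : 0 < δ) :
    Tendsto (fun s : ℝ => s ^ n * Real.exp (-(s * δ))) atTop (𝓝 0) := by
  have h := ((Real.tendsto_pow_mul_exp_neg_atTop_nhds_zero n).comp
    (tendsto_id.atTop_mul_const hδ)).const_mul ((δ ^ n)⁻¹)
  simp only [mul_zero] at h
  refine h.congr fun s => ?_
  simp only [Function.comp, id]
  rw [mul_pow]
  field_simp

theorem intervalIntegrable_exp_mul {g : ℝ → ℝ} {a b : ℝ} (hg : IntervalIntegrable g volume a b)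
    (s : ℝ) : IntervalIntegrable (fun t => Real.exp (-(s * t)) * g t) volume a b :=
  hg.continuousOn_mul (by fun_prop)

theorem laplaceMean_add {g h : ℝ → ℝ} {δ : ℝ} (hg : IntervalIntegrable g volume 0 δ)
    (hh : IntervalIntegrable h volume 0 δ) (s : ℝ) :
    laplaceMean (fun t => g t + h t) δ s = laplaceMean g δ s + laplaceMean h δ s := by
  unfold laplaceMean
  rw [← mul_add, ← intervalIntegral.integral_add (intervalIntegrable_exp_mul hg s)
    (intervalIntegrable_exp_mul hh s)]
  simp only [mul_add]

theorem laplaceMean_const_mul (g : ℝ → ℝ) (c δ s : ℝ) :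
    laplaceMean (fun t => c * g t) δ s = c * laplaceMean g δ s := by
  unfold laplaceMean
  rw [mul_left_comm c, ← intervalIntegral.integral_const_mul c]
  congr 2
  ext t
  ring

theorem laplaceMean_neg (g : ℝ → ℝ) (δ s : ℝ) :
    laplaceMean (fun t => -g t) δ s = -laplaceMean g δ s := by
  simpa using laplaceMean_const_mul g (-1) δ s

/-- This is the normalization behind the factor `s^2`: the full integral of `t e^(-st)` is `1/s^2`,
and truncation at `δ` costs only exponentially small terms. -/
theorem tendsto_laplaceMean_id {δ : ℝ} (hδ : 0 < δ) :
    Tendsto (laplaceMean (fun t => t) δ) atTop (𝓝 1) := by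
  have h : ∀ s : ℝ, 0 < s →
      laplaceMean (fun t => t) δ s
        = 1 - s ^ 0 * Real.exp (-(s * δ)) - δ * (s ^ 1 * Real.exp (-(s * δ))) := by
    intro s hs
    have hd : ∀ t ∈ uIcc 0 δ, HasDerivAt (fun t => -(t / s + 1 / s ^ 2) * Real.exp (-(s * t)))
        (Real.exp (-(s * t)) * t) t := by
      intro t _
      have h1 : HasDerivAt (fun t : ℝ => -(t / s + 1 / s ^ 2)) (-(1 / s)) t :=
        (((hasDerivAt_id t).div_const s).add_const _).neg
      have h2 : HasDerivAt (fun t : ℝ => Real.exp (-(s * t))) (Real.exp (-(s * t)) * -(s * 1)) t :=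
        (((hasDerivAt_id t).const_mul s).neg).exp
      refine (h1.fun_mul h2).congr_deriv ?_
      field_simp
      ring
    unfold laplaceMean
    rw [intervalIntegral.integral_eq_sub_of_hasDerivAt hd
      (Continuous.intervalIntegrable (by fun_prop) _ _)]
    simp only [mul_zero, neg_zero, Real.exp_zero]
    field_simp
    ring
  have h1 := (((tendsto_pow_mul_exp_neg_mul 0 hδ).const_sub 1).sub
    ((tendsto_pow_mul_exp_neg_mul 1 hδ).const_mul δ))
  simp only [mul_zero, sub_zero] at h1
  refine h1.congr' ?_
  filter_upwards [eventually_gt_atTop 0] with s hs using (h s hs).symm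

/-- Beyond `η` the kernel is at most `e^(-sη)`, which beats `s^2`. This makes Laplace limits
independent of `δ`. -/
theorem tendsto_laplace_tail {g : ℝ → ℝ} {η δ : ℝ} (hη : 0 < η) (hηδ : η ≤ δ)
    (hg : IntervalIntegrable g volume η δ) :
    Tendsto (fun s : ℝ => s ^ 2 * ∫ t in η..δ, Real.exp (-(s * t)) * g t) atTop (𝓝 0) := by
  have h := (tendsto_pow_mul_exp_neg_mul 2 hη).mul_const (∫ t in η..δ, |g t|)
  rw [zero_mul] at h
  refine squeeze_zero_norm' ?_ h
  filter_upwards [eventually_gt_atTop 0] with s hs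
  rw [norm_mul, Real.norm_of_nonneg (sq_nonneg s), mul_assoc]
  gcongr
  rw [← intervalIntegral.integral_const_mul]
  refine intervalIntegral.norm_integral_le_of_norm_le hηδ ?_ (hg.abs.const_mul _)
  refine Eventually.of_forall fun t ht => ?_
  rw [norm_mul, Real.norm_eq_abs, Real.norm_eq_abs, Real.abs_exp]
  have := ht.1.le
  gcongr

theorem tendsto_laplaceMean_sub {g : ℝ → ℝ} {η δ : ℝ} (hη : 0 < η) (hηδ : η ≤ δ)
    (hg : IntervalIntegrable g volume 0 δ) :
    Tendsto (fun s => laplaceMean g δ s - laplaceMean g η s) atTop (𝓝 0) := by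
  have h1 : IntervalIntegrable g volume 0 η :=
    hg.mono_set (by rw [uIcc_of_le hη.le, uIcc_of_le (hη.le.trans hηδ)]; exact Icc_subset_Icc_right hηδ)
  have h2 : IntervalIntegrable g volume η δ :=
    hg.mono_set (by rw [uIcc_of_le hηδ, uIcc_of_le (hη.le.trans hηδ)]; exact Icc_subset_Icc_left hη.le)
  refine (tendsto_laplace_tail hη hηδ h2).congr fun s => ?_
  unfold laplaceMean
  rw [← intervalIntegral.integral_add_adjacent_intervals (intervalIntegrable_exp_mul h1 s)
    (intervalIntegrable_exp_mul h2 s)]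
  ring

/-- The kernel is positive, so a linear lower bound near 0 survives averaging. The slack between
`r'` and `r` absorbs the tail and the error in the mean of `t`. -/
theorem eventually_lt_laplaceMean {g : ℝ → ℝ} {η δ r r' : ℝ} (hη : 0 < η) (hηδ : η ≤ δ)
    (hg : IntervalIntegrable g volume 0 δ) (h : ∀ t ∈ Ioo 0 η, r * t ≤ g t) (hr : r' < r) :
    ∀ᶠ s in atTop, r' < laplaceMean g δ s := by
  have h1 : IntervalIntegrable g volume 0 η :=
    hg.mono_set (by rw [uIcc_of_le hη.le, uIcc_of_le (hη.le.trans hηδ)]; exact Icc_subset_Icc_right hηδ)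
  have h2 := (tendsto_laplaceMean_sub hη hηδ hg).add ((tendsto_laplaceMean_id hη).const_mul r)
  rw [zero_add, mul_one] at h2
  filter_upwards [h2.eventually_const_lt hr] with s hs
  have h3 : r * laplaceMean (fun t => t) η s ≤ laplaceMean g η s := by
    rw [← laplaceMean_const_mul]
    unfold laplaceMean
    refine mul_le_mul_of_nonneg_left ?_ (sq_nonneg s)
    refine intervalIntegral.integral_mono_on_of_le_Ioo hη.le
      (intervalIntegrable_exp_mul (Continuous.intervalIntegrable (by fun_prop) _ _) s)
      (intervalIntegrable_exp_mul h1 s) fun t ht => ?_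
    exact mul_le_mul_of_nonneg_left (h t ht) (Real.exp_pos _).le
  linarith

theorem tendsto_laplaceMean_of_tendsto_div {g : ℝ → ℝ} {δ L : ℝ} (hδ : 0 < δ)
    (hg : IntervalIntegrable g volume 0 δ)
    (h : Tendsto (fun t => g t / t) (𝓝[>] 0) (𝓝 L)) :
    Tendsto (laplaceMean g δ) atTop (𝓝 L) := by
  refine tendsto_order.2 ⟨fun r hr => ?_, fun r hr => ?_⟩
  · obtain ⟨r₁, hr₁, hr₁'⟩ := exists_between hr
    have h1 := h.eventually_const_lt hr₁'
    rw [eventually_nhdsWithin_iff, Metric.eventually_nhds_iff] at h1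
    obtain ⟨ε, hε, h1⟩ := h1
    refine eventually_lt_laplaceMean (lt_min hε hδ) (min_le_right _ _) hg (r := r₁) ?_ hr₁
    intro t ht
    have := h1 (y := t) (by
      rw [Real.dist_eq, sub_zero, abs_of_pos ht.1]; exact ht.2.trans_le (min_le_left _ _)) ht.1
    exact ((lt_div_iff₀ ht.1).1 this).le
  · obtain ⟨r₁, hr₁, hr₁'⟩ := exists_between hr
    have h1 := h.eventually_lt_const hr₁
    rw [eventually_nhdsWithin_iff, Metric.eventually_nhds_iff] at h1
    obtain ⟨ε, hε, h1⟩ := h1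
    have := eventually_lt_laplaceMean (lt_min hε hδ) (min_le_right _ _) hg.neg (r := -r₁)
      (r' := -r) ?_ (by linarith)
    · filter_upwards [this] with s hs
      change -r < laplaceMean (fun t => -g t) δ s at hs
      rw [laplaceMean_neg] at hs
      linarith
    · intro t ht
      have := h1 (y := t) (by
        rw [Real.dist_eq, sub_zero, abs_of_pos ht.1]; exact ht.2.trans_le (min_le_left _ _)) ht.1
      have := ((div_lt_iff₀ ht.1).1 this).le
      simp only [Pi.neg_apply]
      linarith

theorem integral_exp_mul_cube_le {s δ : ℝ} (hs : 0 < s) (hδ : 0 ≤ δ) :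
    ∫ t in (0 : ℝ)..δ, Real.exp (-(s * t)) * t ^ 3 ≤ 6 / s ^ 4 := by
  have hd : ∀ t ∈ uIcc 0 δ, HasDerivAt
      (fun t => -(t ^ 3 / s + 3 * t ^ 2 / s ^ 2 + 6 * t / s ^ 3 + 6 / s ^ 4) * Real.exp (-(s * t)))
      (Real.exp (-(s * t)) * t ^ 3) t := by
    intro t _
    have h1 : HasDerivAt (fun t : ℝ => -(t ^ 3 / s + 3 * t ^ 2 / s ^ 2 + 6 * t / s ^ 3 + 6 / s ^ 4))
        (-(((3 : ℕ) * t ^ (3 - 1)) / s + 3 * ((2 : ℕ) * t ^ (2 - 1)) / s ^ 2 + 6 * 1 / s ^ 3)) t :=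
      (((((hasDerivAt_pow 3 t).div_const s).add
        (((hasDerivAt_pow 2 t).const_mul 3).div_const (s ^ 2))).add
        (((hasDerivAt_id t).const_mul 6).div_const (s ^ 3))).add_const _).neg
    have h2 : HasDerivAt (fun t : ℝ => Real.exp (-(s * t))) (Real.exp (-(s * t)) * -(s * 1)) t :=
      (((hasDerivAt_id t).const_mul s).neg).exp
    refine (h1.fun_mul h2).congr_deriv ?_
    push_cast
    field_simp
    ring
  rw [intervalIntegral.integral_eq_sub_of_hasDerivAt hd
    (Continuous.intervalIntegrable (by fun_prop) _ _)]
  simp only [mul_zero, neg_zero, Real.exp_zero]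
  have : 0 ≤ (δ ^ 3 / s + 3 * δ ^ 2 / s ^ 2 + 6 * δ / s ^ 3 + 6 / s ^ 4) * Real.exp (-(s * δ)) := by
    positivity
  norm_num
  linarith

/-- Integration by parts costs one factor `s`, and the cubic bound turns `s^3 ∫ e^(-st) G` into
`O(1/s)`. No pointwise smallness of `g` is needed. -/
theorem tendsto_laplaceMean_zero_of_primitive_le {g : ℝ → ℝ} {δ C : ℝ} (hδ : 0 < δ)
    (hg : Continuous g) (h : ∀ t ∈ Icc 0 δ, |∫ u in (0 : ℝ)..t, g u| ≤ C * t ^ 3) :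
    Tendsto (laplaceMean g δ) atTop (𝓝 0) := by
  set G : ℝ → ℝ := fun t => ∫ u in (0 : ℝ)..t, g u with hG
  have hGd : ∀ t, HasDerivAt G (g t) t := fun t => hg.integral_hasStrictDerivAt 0 t |>.hasDerivAt
  have hGc : Continuous G := continuous_iff_continuousAt.2 fun t => (hGd t).continuousAt
  have hparts : ∀ s : ℝ, laplaceMean g δ s
      = s ^ 2 * Real.exp (-(s * δ)) * G δ
        + s ^ 3 * ∫ t in (0 : ℝ)..δ, Real.exp (-(s * t)) * G t := by
    intro s
    have h2 : ∀ t : ℝ, HasDerivAt (fun t : ℝ => Real.exp (-(s * t)))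
        (Real.exp (-(s * t)) * -(s * 1)) t := fun t =>
      (((hasDerivAt_id t).const_mul s).neg).exp
    unfold laplaceMean
    rw [intervalIntegral.integral_mul_deriv_eq_deriv_mul (fun t _ => h2 t) (fun t _ => hGd t)
      (Continuous.intervalIntegrable (by fun_prop) _ _) (hg.intervalIntegrable _ _)]
    have h0 : G 0 = 0 := by simp [hG]
    have h3 : (∫ t in (0 : ℝ)..δ, Real.exp (-(s * t)) * -(s * 1) * G t)
        = -s * ∫ t in (0 : ℝ)..δ, Real.exp (-(s * t)) * G t := by
      rw [← intervalIntegral.integral_const_mul]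
      congr 1
      ext t
      ring
    rw [h0, h3]
    ring
  have h1 := (tendsto_pow_mul_exp_neg_mul 2 hδ).mul_const (G δ)
  have h2 : Tendsto (fun s : ℝ => s ^ 3 * ∫ t in (0 : ℝ)..δ, Real.exp (-(s * t)) * G t)
      atTop (𝓝 0) := by
    have h3 : Tendsto (fun s : ℝ => C * 6 * s⁻¹) atTop (𝓝 0) := by
      simpa using tendsto_inv_atTop_zero.const_mul (C * 6)
    have hC : 0 ≤ C := by
      have := (abs_nonneg _).trans (h δ ⟨hδ.le, le_rfl⟩)
      exact nonneg_of_mul_nonneg_left this (by positivity)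
    refine squeeze_zero_norm' ?_ h3
    filter_upwards [eventually_gt_atTop 0] with s hs
    have h4 : ‖∫ t in (0 : ℝ)..δ, Real.exp (-(s * t)) * G t‖
        ≤ ∫ t in (0 : ℝ)..δ, C * (Real.exp (-(s * t)) * t ^ 3) := by
      refine intervalIntegral.norm_integral_le_of_norm_le hδ.le ?_
        (Continuous.intervalIntegrable (by fun_prop) _ _)
      refine Eventually.of_forall fun t ht => ?_
      rw [norm_mul, Real.norm_eq_abs, Real.norm_eq_abs, Real.abs_exp, mul_left_comm]
      exact mul_le_mul_of_nonneg_left (h t ⟨ht.1.le, ht.2⟩) (Real.exp_pos _).le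
    rw [intervalIntegral.integral_const_mul] at h4
    have h5 := mul_le_mul_of_nonneg_left (integral_exp_mul_cube_le hs hδ.le) hC
    rw [norm_mul, norm_pow, Real.norm_of_nonneg hs.le]
    calc s ^ 3 * ‖∫ t in (0 : ℝ)..δ, Real.exp (-(s * t)) * G t‖
        ≤ s ^ 3 * (C * (6 / s ^ 4)) := by gcongr; exact h4.trans h5
      _ = C * 6 * s⁻¹ := by field_simp
  have := h1.add h2
  rw [zero_mul, zero_add] at this
  exact this.congr fun s => (hparts s).symm

/-! ### Lower Laplace derivates -/

theorem coe_le_liminf_coe_iff {c : EReal} {u : ℝ → ℝ} :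
    c ≤ liminf (fun s : ℝ => (u s : EReal)) atTop ↔
      ∀ r : ℝ, (r : EReal) < c → ∀ᶠ s in atTop, r < u s := by
  rw [le_liminf_iff]
  constructor
  · intro h r hr
    filter_upwards [h r hr] with s hs using EReal.coe_lt_coe_iff.1 hs
  · intro h y hy
    obtain ⟨z, hz, hz'⟩ := EReal.lt_iff_exists_real_btwn.1 hy
    filter_upwards [h z hz'] with s hs using hz.trans (EReal.coe_lt_coe_iff.2 hs)

theorem le_lowerLaplaceDeriv_iff {F : ℝ → ℝ} {a b x : ℝ} {c : EReal} :
    c ≤ lowerLaplaceDeriv F a b x ↔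
      (x < b → ∀ r : ℝ, (r : EReal) < c → ∀ᶠ s in atTop, r < laplaceQuotRight F x (b - x) s) ∧
      (a < x → ∀ r : ℝ, (r : EReal) < c → ∀ᶠ s in atTop, r < laplaceQuotLeft F x (x - a) s) := by
  unfold lowerLaplaceDeriv
  rw [le_inf_iff]
  refine and_congr ?_ ?_
  · split_ifs with h
    · simp only [h, true_imp_iff, coe_le_liminf_coe_iff]
    · simp [h]
  · split_ifs with h
    · simp only [h, true_imp_iff, coe_le_liminf_coe_iff]
    · simp [h]

theorem intervalIntegrable_right_increment {F : ℝ → ℝ} {x δ : ℝ}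
    (hF : IntervalIntegrable F volume x (x + δ)) :
    IntervalIntegrable (fun t => F (x + t) - F x) volume 0 δ := by
  have := hF.comp_add_left x
  simp only [sub_self, add_sub_cancel_left] at this
  exact this.sub intervalIntegrable_const

theorem intervalIntegrable_left_increment {F : ℝ → ℝ} {x δ : ℝ}
    (hF : IntervalIntegrable F volume (x - δ) x) :
    IntervalIntegrable (fun t => F x - F (x - t)) volume 0 δ := by
  have := hF.symm.comp_sub_left x
  simp only [sub_self, sub_sub_cancel] at this
  exact intervalIntegrable_const.sub this

theorem ContinuousOn.intervalIntegrable_right {F : ℝ → ℝ} {a b x : ℝ}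
    (hF : ContinuousOn F (Icc a b)) (hx : x ∈ Icc a b) :
    IntervalIntegrable F volume x (x + (b - x)) := by
  rw [add_sub_cancel]
  refine ContinuousOn.intervalIntegrable_of_Icc hx.2 (hF.mono (Icc_subset_Icc_left hx.1))

theorem ContinuousOn.intervalIntegrable_left {F : ℝ → ℝ} {a b x : ℝ}
    (hF : ContinuousOn F (Icc a b)) (hx : x ∈ Icc a b) :
    IntervalIntegrable F volume (x - (x - a)) x := by
  rw [sub_sub_cancel]
  refine ContinuousOn.intervalIntegrable_of_Icc hx.1 (hF.mono (Icc_subset_Icc_right hx.2))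

theorem eventually_lt_laplaceQuotRight {F : ℝ → ℝ} {x δ η r r' : ℝ}
    (hF : IntervalIntegrable F volume x (x + δ)) (hη : 0 < η) (hηδ : η ≤ δ)
    (h : ∀ t ∈ Ioo 0 η, r * t ≤ F (x + t) - F x) (hr : r' < r) :
    ∀ᶠ s in atTop, r' < laplaceQuotRight F x δ s :=
  eventually_lt_laplaceMean hη hηδ (intervalIntegrable_right_increment hF) h hr

theorem eventually_lt_laplaceQuotLeft {F : ℝ → ℝ} {x δ η r r' : ℝ}
    (hF : IntervalIntegrable F volume (x - δ) x) (hη : 0 < η) (hηδ : η ≤ δ)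
    (h : ∀ t ∈ Ioo 0 η, r * t ≤ F x - F (x - t)) (hr : r' < r) :
    ∀ᶠ s in atTop, r' < laplaceQuotLeft F x δ s := by
  simp only [laplaceQuotLeft_eq_mean]
  exact eventually_lt_laplaceMean hη hηδ (intervalIntegrable_left_increment hF) h hr

theorem laplaceQuotRight_add {F G : ℝ → ℝ} {x δ : ℝ}
    (hF : IntervalIntegrable F volume x (x + δ)) (hG : IntervalIntegrable G volume x (x + δ))
    (s : ℝ) : laplaceQuotRight (fun y => F y + G y) x δ s
      = laplaceQuotRight F x δ s + laplaceQuotRight G x δ s := by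
  simp only [laplaceQuotRight_eq_mean]
  rw [← laplaceMean_add (intervalIntegrable_right_increment hF)
    (intervalIntegrable_right_increment hG)]
  congr 1
  ext t
  ring

theorem laplaceQuotLeft_add {F G : ℝ → ℝ} {x δ : ℝ}
    (hF : IntervalIntegrable F volume (x - δ) x) (hG : IntervalIntegrable G volume (x - δ) x)
    (s : ℝ) : laplaceQuotLeft (fun y => F y + G y) x δ s
      = laplaceQuotLeft F x δ s + laplaceQuotLeft G x δ s := by
  simp only [laplaceQuotLeft_eq_mean]
  rw [← laplaceMean_add (intervalIntegrable_left_increment hF)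
    (intervalIntegrable_left_increment hG)]
  congr 1
  ext t
  ring

theorem laplaceQuotRight_neg (F : ℝ → ℝ) (x δ s : ℝ) :
    laplaceQuotRight (fun y => -F y) x δ s = -laplaceQuotRight F x δ s := by
  simp only [laplaceQuotRight_eq_mean]
  rw [← laplaceMean_neg]
  congr 1
  ext t
  ring

theorem laplaceQuotLeft_neg (F : ℝ → ℝ) (x δ s : ℝ) :
    laplaceQuotLeft (fun y => -F y) x δ s = -laplaceQuotLeft F x δ s := by
  simp only [laplaceQuotLeft_eq_mean]
  rw [← laplaceMean_neg]
  congr 1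
  ext t
  ring

/-- Passes from the unspecified `δ` to the maximal one, which `lowerLaplaceDeriv` uses. -/
theorem HasRightLaplaceDeriv.tendsto {F : ℝ → ℝ} {a b x L : ℝ}
    (h : HasRightLaplaceDeriv F b L x) (hF : ContinuousOn F (Icc a b)) (hx : x ∈ Icc a b) :
    Tendsto (laplaceQuotRight F x (b - x)) atTop (𝓝 L) := by
  obtain ⟨δ, hδ, hδb, -, h⟩ := h
  have := (tendsto_laplaceMean_sub hδ (by linarith)
    (intervalIntegrable_right_increment (hF.intervalIntegrable_right hx))).add h
  rw [zero_add] at this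
  refine this.congr fun s => ?_
  simp only [laplaceQuotRight_eq_mean]
  ring

theorem HasLeftLaplaceDeriv.tendsto {F : ℝ → ℝ} {a b x L : ℝ}
    (h : HasLeftLaplaceDeriv F a L x) (hF : ContinuousOn F (Icc a b)) (hx : x ∈ Icc a b) :
    Tendsto (laplaceQuotLeft F x (x - a)) atTop (𝓝 L) := by
  obtain ⟨δ, hδ, hδb, -, h⟩ := h
  simp only [laplaceQuotLeft_eq_mean] at h
  have := (tendsto_laplaceMean_sub hδ (by linarith)
    (intervalIntegrable_left_increment (hF.intervalIntegrable_left hx))).add h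
  rw [zero_add] at this
  refine this.congr fun s => ?_
  simp only [laplaceQuotLeft_eq_mean]
  ring

theorem HasRightLaplaceDeriv.neg {F : ℝ → ℝ} {b x L : ℝ} (h : HasRightLaplaceDeriv F b L x) :
    HasRightLaplaceDeriv (fun y => -F y) b (-L) x := by
  obtain ⟨δ, hδ, hδb, hi, h⟩ := h
  refine ⟨δ, hδ, hδb, hi.neg, ?_⟩
  simp only [laplaceQuotRight_neg]
  exact h.neg

theorem HasLeftLaplaceDeriv.neg {F : ℝ → ℝ} {a x L : ℝ} (h : HasLeftLaplaceDeriv F a L x) :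
    HasLeftLaplaceDeriv (fun y => -F y) a (-L) x := by
  obtain ⟨δ, hδ, hδb, hi, h⟩ := h
  refine ⟨δ, hδ, hδb, hi.neg, ?_⟩
  simp only [laplaceQuotLeft_neg]
  exact h.neg

theorem HasLaplaceDeriv.neg {F : ℝ → ℝ} {a b x L : ℝ} (h : HasLaplaceDeriv F a b L x) :
    HasLaplaceDeriv (fun y => -F y) a b (-L) x :=
  ⟨fun hx => (h.1 hx).neg, fun hx => (h.2 hx).neg⟩

theorem lowerDerivate_le_lowerLaplaceDeriv {F : ℝ → ℝ} {a b x : ℝ}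
    (hF : ContinuousOn F (Icc a b)) (hx : x ∈ Icc a b) :
    lowerDerivate F a b x ≤ lowerLaplaceDeriv F a b x := by
  have key : ∀ r : ℝ, (r : EReal) < lowerDerivate F a b x → ∃ r₁ > r, ∃ ε > 0,
      ∀ y ∈ Icc a b, y ≠ x → |y - x| < ε → r₁ < (F y - F x) / (y - x) := by
    intro r hr
    obtain ⟨r₁, hr₁, hr₁'⟩ := EReal.lt_iff_exists_real_btwn.1 hr
    have h := eventually_lt_of_lt_liminf hr₁'
    rw [eventually_nhdsWithin_iff, Metric.eventually_nhds_iff] at h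
    obtain ⟨ε, hε, h⟩ := h
    refine ⟨r₁, EReal.coe_lt_coe_iff.1 hr₁, ε, hε, fun y hy hyx hyε => ?_⟩
    exact EReal.coe_lt_coe_iff.1 (h (y := y) hyε ⟨hy, hyx⟩)
  refine le_lowerLaplaceDeriv_iff.2 ⟨fun hxb r hr => ?_, fun hxa r hr => ?_⟩
  · obtain ⟨r₁, hr₁, ε, hε, h⟩ := key r hr
    refine eventually_lt_laplaceQuotRight (hF.intervalIntegrable_right hx)
      (lt_min hε (sub_pos.2 hxb)) (min_le_right _ _) (fun t ht => ?_) hr₁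
    have h1 := ht.2.trans_le (min_le_left _ _)
    have h2 := ht.2.trans_le (min_le_right _ _)
    have h0 := ht.1
    have := h (x + t) ⟨by linarith [hx.1], by linarith⟩ (by linarith)
      (by rwa [add_sub_cancel_left, abs_of_pos h0])
    rw [add_sub_cancel_left, lt_div_iff₀ h0] at this
    exact this.le
  · obtain ⟨r₁, hr₁, ε, hε, h⟩ := key r hr
    refine eventually_lt_laplaceQuotLeft (hF.intervalIntegrable_left hx)
      (lt_min hε (sub_pos.2 hxa)) (min_le_right _ _) (fun t ht => ?_) hr₁
    have h1 := ht.2.trans_le (min_le_left _ _)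
    have h2 := ht.2.trans_le (min_le_right _ _)
    have h0 := ht.1
    have := h (x - t) ⟨by linarith, by linarith [hx.2]⟩ (by linarith)
      (by rwa [sub_sub_cancel_left, abs_neg, abs_of_pos h0])
    rw [sub_sub_cancel_left, div_neg, ← neg_div, neg_sub, lt_div_iff₀ h0] at this
    exact this.le

/-! ### Monotonicity from right Laplace derivates; comparison of major and minor functions -/

/-- A continuous function with positive lower right Laplace derivates is nondecreasing. -/
theorem monotoneOn_of_laplaceQuotRight_pos {F : ℝ → ℝ} {a b : ℝ} (hF : ContinuousOn F (Icc a b))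
    (h : ∀ x ∈ Ico a b, ∃ r > 0, ∀ᶠ s in atTop, r < laplaceQuotRight F x (b - x) s) :
    MonotoneOn F (Icc a b) := by
  intro u hu v hv huv
  have hsub : Icc u v ⊆ Icc a b := Icc_subset_Icc hu.1 hv.2
  -- If a maximum were attained at some `z < v`, increments to its right would be nonpositive, which
  -- contradicts the positive right derivate at `z`.
  obtain ⟨z, hz, hmax⟩ := isCompact_Icc.exists_isMaxOn (nonempty_Icc.2 huv) (hF.mono hsub)
  rcases hz.2.eq_or_lt with rfl | hzv
  · exact hmax ⟨le_rfl, huv⟩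
  · exfalso
    obtain ⟨r, hr, hev⟩ := h z ⟨(hsub hz).1, hzv.trans_le hv.2⟩
    have h1 := eventually_lt_laplaceQuotRight (F := fun y => -F y) (r := 0) (r' := -r)
      (hF.neg.intervalIntegrable_right (hsub hz)) (sub_pos.2 hzv) (by linarith [hv.2])
      (fun t ht => by
        have : F (z + t) ≤ F z := hmax ⟨by linarith [ht.1, hz.1], by linarith [ht.2]⟩
        linarith) (by linarith)
    obtain ⟨s, hs, hs'⟩ := (hev.and h1).exists
    rw [laplaceQuotRight_neg] at hs'
    linarith

/-- A continuous function with nonnegative lower right Laplace derivates is nondecreasing. -/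
theorem monotoneOn_of_laplaceQuotRight_nonneg {F : ℝ → ℝ} {a b : ℝ}
    (hF : ContinuousOn F (Icc a b))
    (h : ∀ x ∈ Ico a b, ∀ r < 0, ∀ᶠ s in atTop, r < laplaceQuotRight F x (b - x) s) :
    MonotoneOn F (Icc a b) := by
  intro u hu v hv huv
  refine le_of_forall_pos_le_add fun ε hε => ?_
  -- Adding slope `c` makes the derivates positive and changes the increment by less than `ε`; the
  -- `+ 1` covers `u = v`.
  set c := ε / (v - u + 1) with hc
  have hpos : 0 < v - u + 1 := by linarith
  have hcpos : 0 < c := by positivity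
  have hid : Continuous fun y : ℝ => c * y := by fun_prop
  have hmono := monotoneOn_of_laplaceQuotRight_pos (F := fun y => F y + c * y)
    (hF.add hid.continuousOn) (fun x hx => by
      refine ⟨c / 4, by positivity, ?_⟩
      have hx' : x ∈ Icc a b := ⟨hx.1, hx.2.le⟩
      have h1 := eventually_lt_laplaceQuotRight (F := fun y => c * y) (r := c) (r' := c / 2)
        (x := x) (hid.intervalIntegrable x (x + (b - x))) (sub_pos.2 hx.2) le_rfl
        (fun t _ => by linarith) (by linarith)
      filter_upwards [h x hx (-(c / 4)) (by linarith), h1] with s hs hs'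
      rw [laplaceQuotRight_add (hF.intervalIntegrable_right hx') (hid.intervalIntegrable _ _)]
      linarith)
  have h1 : F u + c * u ≤ F v + c * v := hmono hu hv huv
  have h2 : c * (v - u + 1) = ε := by rw [hc]; field_simp
  nlinarith

/-- The finite value `f x` cancels in `U - V`, which leaves nonnegative lower right derivates, so `U
- V` is nondecreasing. -/
theorem sub_le_sub_of_isLaplaceMinor_of_isLaplaceMajor {f U V : ℝ → ℝ} {a b : ℝ} (hab : a ≤ b)
    (hV : IsLaplaceMinor f a b V) (hU : IsLaplaceMajor f a b U) : V b - V a ≤ U b - U a := by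
  have hmono : MonotoneOn (fun y => U y + -V y) (Icc a b) := by
    refine monotoneOn_of_laplaceQuotRight_nonneg (hU.1.add hV.1) fun x hx r hr => ?_
    have hx' : x ∈ Icc a b := ⟨hx.1, hx.2.le⟩
    have h1 := (le_lowerLaplaceDeriv_iff.1 (hU.2 x hx').1).1 hx.2 (f x + r / 2)
      (EReal.coe_lt_coe_iff.2 (by linarith))
    have h2 := (le_lowerLaplaceDeriv_iff.1 (hV.2 x hx').1).1 hx.2 (-f x + r / 2)
      (EReal.coe_lt_coe_iff.2 (by linarith))
    filter_upwards [h1, h2] with s hs hs'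
    rw [laplaceQuotRight_add (hU.1.intervalIntegrable_right hx')
      (hV.1.intervalIntegrable_right hx')]
    linarith
  have := hmono ⟨le_rfl, hab⟩ ⟨hab, le_rfl⟩ hab
  simp only at this
  linarith

theorem sSup_minor_le_sInf_major (f : ℝ → ℝ) {a b : ℝ} (hab : a ≤ b) :
    sSup {r : EReal | ∃ V, IsLaplaceMinor f a b V ∧ r = ((V b - V a : ℝ) : EReal)} ≤
      sInf {r : EReal | ∃ U, IsLaplaceMajor f a b U ∧ r = ((U b - U a : ℝ) : EReal)} := by
  refine sSup_le ?_
  rintro _ ⟨V, hV, rfl⟩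
  refine le_sInf ?_
  rintro _ ⟨U, hU, rfl⟩
  exact EReal.coe_le_coe_iff.2 (sub_le_sub_of_isLaplaceMinor_of_isLaplaceMajor hab hV hU)

theorem IsPerronMajor.isLaplaceMajor {f U : ℝ → ℝ} {a b : ℝ} (h : IsPerronMajor f a b U) :
    IsLaplaceMajor f a b U :=
  ⟨h.1, fun x hx => ⟨(h.2 x hx).1.trans (lowerDerivate_le_lowerLaplaceDeriv h.1 hx),
    (h.2 x hx).2.trans_le (lowerDerivate_le_lowerLaplaceDeriv h.1 hx)⟩⟩

theorem HasPerronIntegral.hasLaplaceIntegral {f : ℝ → ℝ} {a b I : ℝ} (hab : a ≤ b)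
    (h : HasPerronIntegral f a b I) : HasLaplaceIntegral f a b I := by
  have h1 := sSup_minor_le_sInf_major f hab
  have h2 : (I : EReal) ≤
      sSup {r : EReal | ∃ V, IsLaplaceMinor f a b V ∧ r = ((V b - V a : ℝ) : EReal)} := by
    rw [← h.1]
    refine sSup_le_sSup ?_
    rintro _ ⟨V, hV, rfl⟩
    exact ⟨V, IsPerronMajor.isLaplaceMajor hV, rfl⟩
  have h3 : sInf {r : EReal | ∃ U, IsLaplaceMajor f a b U ∧ r = ((U b - U a : ℝ) : EReal)} ≤
      (I : EReal) := by
    rw [← h.2]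
    refine sInf_le_sInf ?_
    rintro _ ⟨U, hU, rfl⟩
    exact ⟨U, hU.isLaplaceMajor, rfl⟩
  exact ⟨le_antisymm (h1.trans h3) h2, le_antisymm h3 (h2.trans h1)⟩

/-! ### Monotone functions with infinite derivative on a countable set -/

/-- A bounded nondecreasing continuous function with infinite derivative at `0`. -/
noncomputable def sqrtRamp (u : ℝ) : ℝ := √(min u 1) - √(min (-u) 1)

theorem continuous_sqrtRamp : Continuous sqrtRamp := by
  unfold sqrtRamp
  fun_prop

theorem monotone_sqrtRamp : Monotone sqrtRamp := by
  intro u v h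
  unfold sqrtRamp
  gcongr

theorem abs_sqrtRamp_le (u : ℝ) : |sqrtRamp u| ≤ 1 := by
  unfold sqrtRamp
  have h1 : √(min u 1) ≤ 1 := Real.sqrt_le_one.2 (min_le_right _ _)
  have h2 : √(min (-u) 1) ≤ 1 := Real.sqrt_le_one.2 (min_le_right _ _)
  rw [abs_le]
  constructor <;> linarith [Real.sqrt_nonneg (min u 1), Real.sqrt_nonneg (min (-u) 1)]

theorem sqrtRamp_neg (u : ℝ) : sqrtRamp (-u) = -sqrtRamp u := by
  unfold sqrtRamp
  rw [neg_neg]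
  ring

theorem sqrtRamp_eq_sqrt {u : ℝ} (h0 : 0 ≤ u) (h1 : u ≤ 1) : sqrtRamp u = √u := by
  unfold sqrtRamp
  rw [min_eq_left h1, Real.sqrt_eq_zero_of_nonpos (x := min (-u) 1), sub_zero]
  exact (min_le_left _ _).trans (by linarith)

theorem sqrtRamp_zero : sqrtRamp 0 = 0 := by
  rw [sqrtRamp_eq_sqrt le_rfl zero_le_one, Real.sqrt_zero]

theorem exists_mul_le_sqrtRamp {k : ℝ} (hk : 0 < k) (M : ℝ) :
    ∃ η > 0, ∀ t ∈ Ioo 0 η, M * t ≤ k * sqrtRamp t := by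
  -- The second bound says `(|M| + 1) √t ≤ k`; multiply by `√t`.
  refine ⟨min 1 ((k / (|M| + 1)) ^ 2), by positivity, fun t ht => ?_⟩
  have h1 : t ≤ 1 := (ht.2.trans_le (min_le_left _ _)).le
  have h2 : t ≤ (k / (|M| + 1)) ^ 2 := (ht.2.trans_le (min_le_right _ _)).le
  rw [sqrtRamp_eq_sqrt ht.1.le h1]
  have h3 : √t ≤ k / (|M| + 1) := Real.sqrt_le_iff.2 ⟨by positivity, h2⟩
  rw [le_div_iff₀ (by positivity)] at h3
  have h4 : √t * √t = t := Real.mul_self_sqrt ht.1.le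
  have h5 := Real.sqrt_nonneg t
  calc M * t ≤ (|M| + 1) * t := by nlinarith [le_abs_self M, ht.1]
    _ = √t * (|M| + 1) * √t := by linear_combination -(|M| + 1) * h4
    _ ≤ k * √t := by gcongr

/-- Superpose translates of `sqrtRamp` with weights of total 1. All terms are nondecreasing, so the
increment of the sum dominates that of the single term centred at `c`, which already has infinite
slope there. -/
theorem exists_monotone_infinite_deriv {C : Set ℝ} (hC : C.Countable) :
    ∃ G : ℝ → ℝ, Continuous G ∧ Monotone G ∧ (∀ x, |G x| ≤ 1) ∧ ∀ c ∈ C, ∀ M : ℝ, ∃ η > 0,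
      ∀ t ∈ Ioo 0 η, M * t ≤ G (c + t) - G c ∧ M * t ≤ G c - G (c - t) := by
  rcases C.eq_empty_or_nonempty with rfl | hne
  · exact ⟨fun _ => 0, continuous_const, monotone_const, by simp, by simp⟩
  obtain ⟨c, rfl⟩ := hC.exists_eq_range hne
  set k : ℕ → ℝ := fun n => 1 / 2 / 2 ^ n with hk
  have hkpos : ∀ n, 0 < k n := fun n => by positivity
  have hks : HasSum k 1 := hasSum_geometric_two' 1
  have hb : ∀ n x, ‖k n * sqrtRamp (x - c n)‖ ≤ k n := fun n x => by
    rw [norm_mul, Real.norm_of_nonneg (hkpos n).le]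
    exact mul_le_of_le_one_right (hkpos n).le (abs_sqrtRamp_le _)
  have hs : ∀ x, Summable fun n => k n * sqrtRamp (x - c n) := fun x =>
    Summable.of_norm_bounded hks.summable fun n => hb n x
  have hinc : ∀ n, ∀ x y, x ≤ y →
      k n * sqrtRamp (y - c n) - k n * sqrtRamp (x - c n) ≤
        (∑' n, k n * sqrtRamp (y - c n)) - ∑' n, k n * sqrtRamp (x - c n) := by
    intro n x y hxy
    rw [← (hs y).tsum_sub (hs x)]
    refine ((hs y).sub (hs x)).le_tsum n fun j _ => ?_
    rw [← mul_sub]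
    exact mul_nonneg (hkpos j).le (sub_nonneg.2 (monotone_sqrtRamp (by linarith)))
  refine ⟨fun x => ∑' n, k n * sqrtRamp (x - c n), ?_, ?_, ?_, ?_⟩
  · refine continuous_tsum (fun n => ?_) hks.summable hb
    exact continuous_const.mul (continuous_sqrtRamp.comp (by fun_prop))
  · intro x y hxy
    refine (hs x).tsum_le_tsum (fun n => ?_) (hs y)
    exact mul_le_mul_of_nonneg_left (monotone_sqrtRamp (by linarith)) (hkpos n).le
  · exact fun x => tsum_of_norm_bounded hks fun n => hb n x
  · rintro _ ⟨n, rfl⟩ M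
    obtain ⟨η, hη, h⟩ := exists_mul_le_sqrtRamp (hkpos n) M
    refine ⟨η, hη, fun t ht => ⟨?_, ?_⟩⟩
    · refine (h t ht).trans ?_
      have := hinc n (c n) (c n + t) (by linarith [ht.1])
      rwa [sub_self, sqrtRamp_zero, add_sub_cancel_left, mul_zero, sub_zero] at this
    · refine (h t ht).trans ?_
      have := hinc n (c n - t) (c n) (by linarith [ht.1])
      rwa [sub_self, sqrtRamp_zero, sub_sub_cancel_left, sqrtRamp_neg, mul_zero, zero_sub,
        mul_neg, neg_neg] at this

/-! ### Laplace primitives with countably many exceptional points -/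

/-- `F` is continuous on `[a, b]`, has Laplace derivative `φ` off `C`, and at the points of `C` its
one-sided Laplace derivatives exist. -/
structure IsLaplacePrimitive (F φ : ℝ → ℝ) (C : Set ℝ) (a b : ℝ) : Prop where
  continuousOn : ContinuousOn F (Icc a b)
  hasLaplaceDeriv : ∀ x ∈ Icc a b \ C, HasLaplaceDeriv F a b (φ x) x
  right : ∀ x ∈ Ico a b, ∃ L, HasRightLaplaceDeriv F b L x
  left : ∀ x ∈ Ioc a b, ∃ L, HasLeftLaplaceDeriv F a L x

theorem IsLaplacePrimitive.neg {F φ : ℝ → ℝ} {C : Set ℝ} {a b : ℝ}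
    (h : IsLaplacePrimitive F φ C a b) :
    IsLaplacePrimitive (fun x => -F x) (fun x => -φ x) C a b where
  continuousOn := h.continuousOn.neg
  hasLaplaceDeriv x hx := (h.hasLaplaceDeriv x hx).neg
  right x hx := (h.right x hx).imp' _ fun _ => HasRightLaplaceDeriv.neg
  left x hx := (h.left x hx).imp' _ fun _ => HasLeftLaplaceDeriv.neg

/-- Take `F + (ε/2) G`. Off `C` monotonicity of `G` does no harm; on `C` its infinite slope
outweighs the finite one-sided derivatives of `F`, whatever `φ` is there. Since `|G| ≤ 1`, the cost
is at most `ε`. -/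
theorem IsLaplacePrimitive.exists_major {F φ : ℝ → ℝ} {C : Set ℝ} {a b : ℝ}
    (h : IsLaplacePrimitive F φ C a b) (hC : C.Countable) {ε : ℝ} (hε : 0 < ε) :
    ∃ U, IsLaplaceMajor φ a b U ∧ U b - U a ≤ F b - F a + ε := by
  obtain ⟨G, hGc, hGm, hGb, hG⟩ := exists_monotone_infinite_deriv hC
  set c := ε / 2 with hc
  have hcpos : 0 < c := by positivity
  have hGc' : Continuous fun y => c * G y := by fun_prop
  refine ⟨fun y => F y + c * G y, ⟨h.continuousOn.add hGc'.continuousOn, fun x hx => ?_⟩, ?_⟩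
  · have key : ((φ x : ℝ) : EReal) ≤ lowerLaplaceDeriv (fun y => F y + c * G y) a b x := by
      refine le_lowerLaplaceDeriv_iff.2 ⟨fun hxb r hr => ?_, fun hxa r hr => ?_⟩
      · rw [EReal.coe_lt_coe_iff] at hr
        simp only [laplaceQuotRight_add (h.continuousOn.intervalIntegrable_right hx)
          (hGc'.intervalIntegrable _ _)]
        by_cases hxC : x ∈ C
        · obtain ⟨L, hL⟩ := h.right x ⟨hx.1, hxb⟩
          -- With this slope `c G` contributes more than `r - L + 1`, and `F` more than `L - 1`.
          obtain ⟨η, hη, hM⟩ := hG x hxC ((r - L + 2) / c)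
          have h1 := eventually_lt_laplaceQuotRight (F := fun y => c * G y) (x := x)
            (δ := b - x) (r := r - L + 2) (r' := r - L + 1) (hGc'.intervalIntegrable _ _)
            (lt_min hη (sub_pos.2 hxb)) (min_le_right _ _) (fun t ht => by
              have := (hM t ⟨ht.1, ht.2.trans_le (min_le_left _ _)⟩).1
              rw [div_mul_eq_mul_div, div_le_iff₀ hcpos] at this
              linarith) (by linarith)
          have h2 := (hL.tendsto h.continuousOn hx).eventually_const_lt
            (show L - 1 < L by linarith)
          filter_upwards [h1, h2] with s h1 h2
          linarith
        · have h1 := eventually_lt_laplaceQuotRight (F := fun y => c * G y) (x := x)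
            (δ := b - x) (r := 0) (r' := (r - φ x) / 2) (hGc'.intervalIntegrable _ _)
            (sub_pos.2 hxb) le_rfl (fun t ht => by
              have := hGm (show x ≤ x + t by linarith [ht.1])
              nlinarith) (by linarith)
          have h2 := (((h.hasLaplaceDeriv x ⟨hx, hxC⟩).1 hxb).tendsto h.continuousOn
            hx).eventually_const_lt (show (r + φ x) / 2 < φ x by linarith)
          filter_upwards [h1, h2] with s h1 h2
          linarith
      · rw [EReal.coe_lt_coe_iff] at hr
        simp only [laplaceQuotLeft_add (h.continuousOn.intervalIntegrable_left hx)
          (hGc'.intervalIntegrable _ _)]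
        by_cases hxC : x ∈ C
        · obtain ⟨L, hL⟩ := h.left x ⟨hxa, hx.2⟩
          obtain ⟨η, hη, hM⟩ := hG x hxC ((r - L + 2) / c)
          have h1 := eventually_lt_laplaceQuotLeft (F := fun y => c * G y) (x := x)
            (δ := x - a) (r := r - L + 2) (r' := r - L + 1) (hGc'.intervalIntegrable _ _)
            (lt_min hη (sub_pos.2 hxa)) (min_le_right _ _) (fun t ht => by
              have := (hM t ⟨ht.1, ht.2.trans_le (min_le_left _ _)⟩).2
              rw [div_mul_eq_mul_div, div_le_iff₀ hcpos] at this
              linarith) (by linarith)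
          have h2 := (hL.tendsto h.continuousOn hx).eventually_const_lt
            (show L - 1 < L by linarith)
          filter_upwards [h1, h2] with s h1 h2
          linarith
        · have h1 := eventually_lt_laplaceQuotLeft (F := fun y => c * G y) (x := x)
            (δ := x - a) (r := 0) (r' := (r - φ x) / 2) (hGc'.intervalIntegrable _ _)
            (sub_pos.2 hxa) le_rfl (fun t ht => by
              have := hGm (show x - t ≤ x by linarith [ht.1])
              nlinarith) (by linarith)
          have h2 := (((h.hasLaplaceDeriv x ⟨hx, hxC⟩).2 hxa).tendsto h.continuousOn
            hx).eventually_const_lt (show (r + φ x) / 2 < φ x by linarith)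
          filter_upwards [h1, h2] with s h1 h2
          linarith
    exact ⟨key, (EReal.bot_lt_coe _).trans_le key⟩
  · have h1 := (abs_le.1 (hGb b)).2
    have h2 := (abs_le.1 (hGb a)).1
    simp only
    nlinarith

/-- Major functions built for `F` and for `-F` pinch both bounds at `F b - F a`. -/
theorem IsLaplacePrimitive.hasLaplaceIntegral {F φ : ℝ → ℝ} {C : Set ℝ} {a b : ℝ}
    (h : IsLaplacePrimitive F φ C a b) (hC : C.Countable) (hab : a ≤ b) :
    HasLaplaceIntegral φ a b (F b - F a) := by
  have h1 := sSup_minor_le_sInf_major φ hab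
  have h2 : ((F b - F a : ℝ) : EReal) ≤
      sSup {r : EReal | ∃ V, IsLaplaceMinor φ a b V ∧ r = ((V b - V a : ℝ) : EReal)} := by
    refine EReal.ge_of_forall_gt_iff_ge.1 fun z hz => ?_
    rw [EReal.coe_lt_coe_iff] at hz
    obtain ⟨U, hU, hUle⟩ := h.neg.exists_major hC (sub_pos.2 hz)
    have hV : IsLaplaceMinor φ a b fun x => -U x := by simpa only [IsLaplaceMinor, neg_neg] using hU
    refine le_trans (b := ((-U b - -U a : ℝ) : EReal)) ?_ (le_sSup ⟨_, hV, rfl⟩)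
    exact EReal.coe_le_coe_iff.2 (by linarith)
  have h3 : sInf {r : EReal | ∃ U, IsLaplaceMajor φ a b U ∧ r = ((U b - U a : ℝ) : EReal)} ≤
      ((F b - F a : ℝ) : EReal) := by
    refine EReal.le_of_forall_lt_iff_le.1 fun z hz => ?_
    rw [EReal.coe_lt_coe_iff] at hz
    obtain ⟨U, hU, hUle⟩ := h.exists_major hC (sub_pos.2 hz)
    refine le_trans (b := ((U b - U a : ℝ) : EReal)) (sInf_le ⟨U, hU, rfl⟩) ?_
    exact EReal.coe_le_coe_iff.2 (by linarith)
  exact ⟨le_antisymm (h1.trans h3) h2, le_antisymm h3 (h2.trans h1)⟩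

/-- If a function with Laplace primitive `F` (off a countable set) has a major function in the sense
of Perron, then `F` has finite lower derivates almost everywhere. -/
theorem IsLaplacePrimitive.ae_eventually_quotient_ge {F φ U : ℝ → ℝ} {C : Set ℝ} {a b : ℝ}
    (h : IsLaplacePrimitive F φ C a b) (hC : C.Countable) (hU : IsPerronMajor φ a b U) :
    ∀ᵐ x ∂volume.restrict (Icc a b), ∃ M : ℝ,
      ∀ᶠ y in 𝓝[Icc a b \ {x}] x, M < (F y - F x) / (y - x) := by
  obtain ⟨G, hGc, hGm, hGb, hG⟩ := exists_monotone_infinite_deriv hC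
  have hFc := h.continuousOn
  have hmono : MonotoneOn (fun y => (U y + G y) + -F y) (Icc a b) := by
    refine monotoneOn_of_laplaceQuotRight_nonneg ((hU.1.add hGc.continuousOn).add hFc.neg)
      fun x hx r hr => ?_
    have hx' : x ∈ Icc a b := ⟨hx.1, hx.2.le⟩
    have hUi := hU.1.intervalIntegrable_right hx'
    have hGi := hGc.intervalIntegrable (μ := volume) x (x + (b - x))
    have hFi := hFc.intervalIntegrable_right hx'
    have h1 := (le_lowerLaplaceDeriv_iff.1 (hU.isLaplaceMajor.2 x hx').1).1 hx.2
      (φ x + r / 3) (EReal.coe_lt_coe_iff.2 (by linarith))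
    have hadd : ∀ s, laplaceQuotRight (fun y => (U y + G y) + -F y) x (b - x) s
        = laplaceQuotRight U x (b - x) s + laplaceQuotRight G x (b - x) s
          - laplaceQuotRight F x (b - x) s := fun s => by
      rw [laplaceQuotRight_add (F := fun y => U y + G y) (G := fun y => -F y) (hUi.add hGi) hFi.neg, laplaceQuotRight_add hUi hGi,
        laplaceQuotRight_neg]
      ring
    simp only [hadd]
    by_cases hxC : x ∈ C
    · obtain ⟨L, hL⟩ := h.right x hx
      -- On `C` the value `φ x` need not be related to `L`; the slope of `G` makes up the
      -- difference.
      obtain ⟨η, hη, hM⟩ := hG x hxC (L - φ x + 2)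
      have h2 := eventually_lt_laplaceQuotRight (r' := L - φ x + 1) hGi
        (lt_min hη (sub_pos.2 hx.2)) (min_le_right _ _)
        (fun t ht => (hM t ⟨ht.1, ht.2.trans_le (min_le_left _ _)⟩).1) (by linarith)
      have h3 := (hL.tendsto hFc hx').eventually_lt_const (show L < L + 1 - r / 3 by linarith)
      filter_upwards [h1, h2, h3] with s h1 h2 h3
      linarith
    · have h2 := eventually_lt_laplaceQuotRight (r := 0) (r' := r / 3) hGi (sub_pos.2 hx.2) le_rfl
        (fun t ht => by
          have := hGm (show x ≤ x + t by linarith [ht.1])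
          linarith) (by linarith)
      have h3 := (((h.hasLaplaceDeriv x ⟨hx', hxC⟩).1 hx.2).tendsto hFc hx').eventually_lt_const
        (show φ x < φ x - r / 3 by linarith)
      filter_upwards [h1, h2, h3] with s h1 h2 h3
      linarith
  -- By Lebesgue's theorem `U + G - F` is differentiable almost everywhere. Where it is, quotients
  -- of `F` are bounded below, since those of `U` are and those of `G` are nonnegative.
  filter_upwards [hmono.ae_differentiableWithinAt measurableSet_Icc,
    ae_restrict_mem measurableSet_Icc] with x hd hx
  have h1 := hasDerivWithinAt_iff_tendsto_slope.1 hd.hasDerivWithinAt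
  set W := derivWithin (fun y => (U y + G y) + -F y) (Icc a b) x
  obtain ⟨r, -, hr⟩ := EReal.lt_iff_exists_real_btwn.1 (hU.2 x hx).2
  have h2 := eventually_lt_of_lt_liminf hr
  refine ⟨r - (W + 1), ?_⟩
  filter_upwards [h1.eventually_lt_const (show W < W + 1 by linarith), h2] with y h1 h2
  rw [EReal.coe_lt_coe_iff] at h2
  rw [slope_def_field] at h1
  have h3 : 0 ≤ (G y - G x) / (y - x) := by
    rcases le_total x y with hxy | hxy
    · exact div_nonneg (sub_nonneg.2 (hGm hxy)) (sub_nonneg.2 hxy)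
    · exact div_nonneg_of_nonpos (sub_nonpos.2 (hGm hxy)) (sub_nonpos.2 hxy)
  have h4 : (U y + G y + -F y - (U x + G x + -F x)) / (y - x)
      = (U y - U x) / (y - x) + (G y - G x) / (y - x) - (F y - F x) / (y - x) := by ring
  rw [h4] at h1
  linarith

/-! ### The components and gaps of the Smith-Volterra-Cantor set -/

/-- The length `(2^(-n) + 4^(-n))/2` solves the recursion "remove `4^(-(n+1))`, then halve". Its
positivity shows that every cut lies strictly inside its component. -/
theorem sub_eq_of_mem_svcComponents {n : ℕ} {q : ℝ × ℝ} (hq : q ∈ svcComponents n) :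
    q.2 - q.1 = (1 / 2) ^ n * (1 + (1 / 2) ^ n) / 2 := by
  induction n generalizing q with
  | zero =>
    rw [svcComponents, mem_singleton_iff] at hq
    subst hq
    norm_num
  | succ n ih =>
    obtain ⟨p, hp, rfl | rfl⟩ := hq <;>
    · have := ih hp
      have h2 : (1 : ℝ) / 2 ^ (2 * (n + 1) + 1) = (1 / 2) ^ n * (1 / 2) ^ n / 8 := by
        rw [← one_div_pow]; ring
      simp only [svcCutLeft, svcCutRight, h2]
      rw [pow_succ]
      linear_combination this / 2

theorem svcCutRight_sub_svcCutLeft (n : ℕ) (q : ℝ × ℝ) :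
    svcCutRight n q - svcCutLeft n q = (1 / 4) ^ (n + 1) := by
  unfold svcCutLeft svcCutRight
  rw [one_div_pow, show (4 : ℝ) = 2 ^ 2 by norm_num, ← pow_mul, pow_succ _ (2 * (n + 1))]
  field_simp
  ring

theorem svcCutLeft_lt_svcCutRight (n : ℕ) (q : ℝ × ℝ) : svcCutLeft n q < svcCutRight n q := by
  have : (0 : ℝ) < (1 / 4) ^ (n + 1) := by positivity
  linarith [svcCutRight_sub_svcCutLeft n q]

theorem lt_svcCutLeft {n : ℕ} {q : ℝ × ℝ} (hq : q ∈ svcComponents n) : q.1 < svcCutLeft n q := by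
  have h := sub_eq_of_mem_svcComponents (n := n + 1) (q := (q.1, svcCutLeft n q)) ⟨q, hq, Or.inl rfl⟩
  have : (0 : ℝ) < (1 / 2) ^ (n + 1) * (1 + (1 / 2) ^ (n + 1)) / 2 := by positivity
  simp only at h
  linarith

theorem svcCutRight_lt {n : ℕ} {q : ℝ × ℝ} (hq : q ∈ svcComponents n) : svcCutRight n q < q.2 := by
  have h := sub_eq_of_mem_svcComponents (n := n + 1) (q := (svcCutRight n q, q.2))
    ⟨q, hq, Or.inr rfl⟩
  have : (0 : ℝ) < (1 / 2) ^ (n + 1) * (1 + (1 / 2) ^ (n + 1)) / 2 := by positivity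
  simp only at h
  linarith

theorem Ioo_svcCut_subset {n : ℕ} {q : ℝ × ℝ} (hq : q ∈ svcComponents n) :
    Ioo (svcCutLeft n q) (svcCutRight n q) ⊆ Icc q.1 q.2 :=
  Ioo_subset_Icc_self.trans (Icc_subset_Icc (lt_svcCutLeft hq).le (svcCutRight_lt hq).le)

theorem mem_svcStage {n : ℕ} {x : ℝ} : x ∈ svcStage n ↔ ∃ q ∈ svcComponents n, x ∈ Icc q.1 q.2 := by
  simp only [svcStage, mem_iUnion, exists_prop]

theorem svcStage_succ_subset (n : ℕ) : svcStage (n + 1) ⊆ svcStage n := by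
  intro x hx
  obtain ⟨p, ⟨q, hq, rfl | rfl⟩, hx⟩ := mem_svcStage.1 hx
  · exact mem_svcStage.2 ⟨q, hq, hx.1, hx.2.trans
      ((svcCutLeft_lt_svcCutRight n q).trans (svcCutRight_lt hq)).le⟩
  · exact mem_svcStage.2 ⟨q, hq, ((lt_svcCutLeft hq).trans
      (svcCutLeft_lt_svcCutRight n q)).le.trans hx.1, hx.2⟩

theorem antitone_svcStage : Antitone svcStage := antitone_nat_of_succ_le svcStage_succ_subset

theorem svcStage_zero : svcStage 0 = Icc 0 1 := by
  simp [svcStage, svcComponents]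

/-- By induction the parents coincide, and two children of one parent are separated by the removed
interval. -/
theorem svcComponents_eq_of_mem {n : ℕ} {p q : ℝ × ℝ} (hp : p ∈ svcComponents n)
    (hq : q ∈ svcComponents n) {x : ℝ} (hxp : x ∈ Icc p.1 p.2) (hxq : x ∈ Icc q.1 q.2) : p = q := by
  induction n generalizing p q with
  | zero =>
    rw [svcComponents, mem_singleton_iff] at hp hq
    rw [hp, hq]
  | succ n ih =>
    obtain ⟨p', hp', hp⟩ := hp
    obtain ⟨q', hq', hq⟩ := hq
    have hc := svcCutLeft_lt_svcCutRight n p'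
    have hc' := svcCutLeft_lt_svcCutRight n q'
    have h1 := lt_svcCutLeft hp'
    have h2 := svcCutRight_lt hp'
    have h3 := lt_svcCutLeft hq'
    have h4 := svcCutRight_lt hq'
    have hx1 : x ∈ Icc p'.1 p'.2 := by
      rcases hp with rfl | rfl <;> constructor <;> linarith [hxp.1, hxp.2]
    have hx2 : x ∈ Icc q'.1 q'.2 := by
      rcases hq with rfl | rfl <;> constructor <;> linarith [hxq.1, hxq.2]
    obtain rfl := ih hp' hq' hx1 hx2
    rcases hp with rfl | rfl <;> rcases hq with rfl | rfl
    · rfl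
    · exact absurd hxp.2 (not_le.2 (hc.trans_le hxq.1))
    · exact absurd hxq.2 (not_le.2 (hc.trans_le hxp.1))
    · rfl

theorem notMem_svcStage_succ {n : ℕ} {q : ℝ × ℝ} (hq : q ∈ svcComponents n) {x : ℝ}
    (hx : x ∈ Ioo (svcCutLeft n q) (svcCutRight n q)) : x ∉ svcStage (n + 1) := by
  intro h
  obtain ⟨p, ⟨p', hp', hp⟩, hxp⟩ := mem_svcStage.1 h
  have hc := svcCutLeft_lt_svcCutRight n p'
  have h1 := lt_svcCutLeft hp'
  have h2 := svcCutRight_lt hp'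
  have hx1 : x ∈ Icc p'.1 p'.2 := by
    rcases hp with rfl | rfl <;> constructor <;> linarith [hxp.1, hxp.2]
  obtain rfl := svcComponents_eq_of_mem hp' hq hx1 (Ioo_svcCut_subset hq hx)
  rcases hp with rfl | rfl
  · exact absurd hxp.2 (not_le.2 hx.1)
  · exact absurd hxp.1 (not_le.2 hx.2)

/-- A point of a gap cut at level `n` lies in stage `n` but not in stage `n + 1`, so it determines
the level, and then the component. -/
theorem svcGaps_eq_of_mem {p q : ℝ × ℝ} (hp : p ∈ svcGaps) (hq : q ∈ svcGaps) {x : ℝ}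
    (hxp : x ∈ Ioo p.1 p.2) (hxq : x ∈ Ioo q.1 q.2) : p = q := by
  obtain ⟨m, p', hp', rfl⟩ := hp
  obtain ⟨n, q', hq', rfl⟩ := hq
  have h1 := notMem_svcStage_succ hp' hxp
  have h2 := notMem_svcStage_succ hq' hxq
  have h3 := Ioo_svcCut_subset hp' hxp
  have h4 := Ioo_svcCut_subset hq' hxq
  rcases lt_trichotomy m n with hmn | rfl | hmn
  · exact absurd (antitone_svcStage hmn (mem_svcStage.2 ⟨q', hq', h4⟩)) h1
  · rw [svcComponents_eq_of_mem hp' hq' h3 h4]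
  · exact absurd (antitone_svcStage hmn (mem_svcStage.2 ⟨p', hp', h3⟩)) h2

theorem notMem_Ioo_of_mem_SVC4 {x : ℝ} (hx : x ∈ SVC4) {p : ℝ × ℝ} (hp : p ∈ svcGaps) :
    x ∉ Ioo p.1 p.2 := by
  obtain ⟨n, q, hq, rfl⟩ := hp
  exact fun h => notMem_svcStage_succ hq h (mem_iInter.1 hx (n + 1))

theorem SVC4_subset_Icc : SVC4 ⊆ Icc 0 1 := by
  rw [← svcStage_zero]
  exact iInter_subset _ 0

theorem svcGaps_Ioo_subset {p : ℝ × ℝ} (hp : p ∈ svcGaps) : Ioo p.1 p.2 ⊆ Icc 0 1 := by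
  obtain ⟨n, q, hq, rfl⟩ := hp
  intro x hx
  rw [← svcStage_zero]
  exact antitone_svcStage n.zero_le (mem_svcStage.2 ⟨q, hq, Ioo_svcCut_subset hq hx⟩)

theorem svcGaps_lt {p : ℝ × ℝ} (hp : p ∈ svcGaps) : p.1 < p.2 := by
  obtain ⟨n, q, -, rfl⟩ := hp
  exact svcCutLeft_lt_svcCutRight n q

theorem exists_svcCut_of_notMem_SVC4 {x : ℝ} (hx : x ∈ Icc (0 : ℝ) 1) (h : x ∉ SVC4) :
    ∃ n, ∃ q ∈ svcComponents n, x ∈ Ioo (svcCutLeft n q) (svcCutRight n q) := by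
  by_contra! hcon
  refine h (mem_iInter.2 fun n => ?_)
  induction n with
  | zero => rwa [svcStage_zero]
  | succ n ih =>
    obtain ⟨q, hq, hxq⟩ := mem_svcStage.1 ih
    have := hcon n q hq
    rw [mem_Ioo, not_and_or, not_lt, not_lt] at this
    rcases this with h | h
    · exact mem_svcStage.2 ⟨_, ⟨q, hq, Or.inl rfl⟩, hxq.1, h⟩
    · exact mem_svcStage.2 ⟨_, ⟨q, hq, Or.inr rfl⟩, h, hxq.2⟩

theorem svcComponents_succ (n : ℕ) : svcComponents (n + 1) =
    (fun q => (q.1, svcCutLeft n q)) '' svcComponents n ∪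
      (fun q => (svcCutRight n q, q.2)) '' svcComponents n := by
  ext p
  simp only [svcComponents, mem_ofPred_eq, mem_union, mem_image]
  constructor
  · rintro ⟨q, hq, rfl | rfl⟩
    · exact Or.inl ⟨q, hq, rfl⟩
    · exact Or.inr ⟨q, hq, rfl⟩
  · rintro (⟨q, hq, rfl⟩ | ⟨q, hq, rfl⟩)
    · exact ⟨q, hq, Or.inl rfl⟩
    · exact ⟨q, hq, Or.inr rfl⟩

theorem finite_svcComponents (n : ℕ) : (svcComponents n).Finite := by
  induction n with
  | zero => exact finite_singleton _
  | succ n ih =>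
    rw [svcComponents_succ]
    exact (ih.image _).union (ih.image _)

theorem ncard_svcComponents_le (n : ℕ) : (svcComponents n).ncard ≤ 2 ^ n := by
  induction n with
  | zero => simp [svcComponents]
  | succ n ih =>
    rw [svcComponents_succ]
    refine (ncard_union_le _ _).trans ?_
    have h := finite_svcComponents n
    have h1 := ncard_image_le (f := fun q : ℝ × ℝ => (q.1, svcCutLeft n q)) h
    have h2 := ncard_image_le (f := fun q : ℝ × ℝ => (svcCutRight n q, q.2)) h
    rw [pow_succ]
    lia

theorem countable_svcGaps : svcGaps.Countable := by
  have : svcGaps = ⋃ n, (fun q => (svcCutLeft n q, svcCutRight n q)) '' svcComponents n := by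
    ext p
    simp only [svcGaps, mem_ofPred_eq, mem_iUnion, mem_image, eq_comm]
  rw [this]
  exact countable_iUnion fun n => ((finite_svcComponents n).image _).countable

theorem countable_svcMidpoints : svcMidpoints.Countable := by
  refine (countable_svcGaps.image fun p => (p.1 + p.2) / 2).mono ?_
  rintro _ ⟨p, hp, rfl⟩
  exact ⟨p, hp, rfl⟩

/-- At most `2^n` intervals of length `4^(-(n+1))` are removed at level `n`, in total at most `1/2 <
1`. -/
theorem volume_SVC4_pos : 0 < volume SVC4 := by
  have hcover : Icc (0 : ℝ) 1 ⊆
      SVC4 ∪ ⋃ n, ⋃ q ∈ svcComponents n, Ioo (svcCutLeft n q) (svcCutRight n q) := by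
    intro x hx
    by_cases h : x ∈ SVC4
    · exact Or.inl h
    · obtain ⟨n, q, hq, h⟩ := exists_svcCut_of_notMem_SVC4 hx h
      exact Or.inr (mem_iUnion.2 ⟨n, mem_iUnion₂.2 ⟨q, hq, h⟩⟩)
  have hlevel : ∀ n, volume (⋃ q ∈ svcComponents n, Ioo (svcCutLeft n q) (svcCutRight n q)) ≤
      ENNReal.ofReal ((1 / 2 : ℝ) / 2 / 2 ^ n) := by
    intro n
    have hf := finite_svcComponents n
    have h1 := measure_biUnion_finset_le (μ := volume) hf.toFinset
      fun q => Ioo (svcCutLeft n q) (svcCutRight n q)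
    simp only [Finite.mem_toFinset] at h1
    refine h1.trans ?_
    simp only [Real.volume_Ioo, svcCutRight_sub_svcCutLeft, Finset.sum_const, nsmul_eq_mul]
    rw [← ncard_eq_toFinset_card _ hf, ← ENNReal.ofReal_natCast,
      ← ENNReal.ofReal_mul (Nat.cast_nonneg _)]
    refine ENNReal.ofReal_le_ofReal ?_
    have h2 : ((svcComponents n).ncard : ℝ) ≤ 2 ^ n := by exact_mod_cast ncard_svcComponents_le n
    calc ((svcComponents n).ncard : ℝ) * (1 / 4) ^ (n + 1) ≤ 2 ^ n * (1 / 4) ^ (n + 1) := by gcongr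
      _ = 1 / 2 / 2 / 2 ^ n := by
        rw [one_div_pow, show (4 : ℝ) = 2 * 2 by norm_num, mul_pow, pow_succ]
        field_simp
  have hgaps : volume (⋃ n, ⋃ q ∈ svcComponents n, Ioo (svcCutLeft n q) (svcCutRight n q)) ≤
      ENNReal.ofReal (1 / 2) := by
    refine (measure_iUnion_le _).trans ((ENNReal.tsum_le_tsum hlevel).trans ?_)
    rw [← ENNReal.ofReal_tsum_of_nonneg (fun n => by positivity) (summable_geometric_two' _),
      tsum_geometric_two']
  by_contra h0
  rw [not_lt, nonpos_iff_eq_zero] at h0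
  have h := (measure_mono (μ := volume) hcover).trans (measure_union_le _ _)
  rw [h0, zero_add, Real.volume_Icc] at h
  have := (ENNReal.ofReal_le_ofReal_iff (by norm_num)).1 (h.trans hgaps)
  norm_num at this

/-- Distance `2^(-n)` against gap length `4^(-(n+1))`: the square-root relation between these scales
destroys differentiability. -/
theorem exists_svcGap_near {x : ℝ} (hx : x ∈ SVC4) (n : ℕ) :
    ∃ p ∈ svcGaps, p.2 - p.1 = (1 / 4) ^ (n + 1) ∧ ∀ y ∈ Ioo p.1 p.2, |y - x| ≤ (1 / 2) ^ n := by
  obtain ⟨q, hq, hxq⟩ := mem_svcStage.1 (mem_iInter.1 hx n)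
  refine ⟨_, ⟨n, q, hq, rfl⟩, svcCutRight_sub_svcCutLeft n q, fun y hy => ?_⟩
  have h1 := Ioo_svcCut_subset hq hy
  have h2 := sub_eq_of_mem_svcComponents hq
  have h3 : (1 / 2 : ℝ) ^ n ≤ 1 := pow_le_one₀ (by norm_num) (by norm_num)
  have h4 : (0 : ℝ) < (1 / 2) ^ n := by positivity
  rw [abs_le]
  constructor <;> nlinarith [h1.1, h1.2, hxq.1, hxq.2]

/-! ### The oscillating function `u^{1/4} sin(u^{-7/4})` -/

/-- `u^{1/4} sin(u^{-7/4})` for `u ≥ 0`, extended by zero. -/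
noncomputable def chirp (u : ℝ) : ℝ :=
  (max u 0) ^ (1 / 4 : ℝ) * Real.sin ((max u 0) ^ (-(7 / 4) : ℝ))

theorem chirp_of_nonneg {u : ℝ} (hu : 0 ≤ u) :
    chirp u = u ^ (1 / 4 : ℝ) * Real.sin (u ^ (-(7 / 4) : ℝ)) := by
  rw [chirp, max_eq_left hu]

theorem chirp_of_nonpos {u : ℝ} (hu : u ≤ 0) : chirp u = 0 := by
  rw [chirp, max_eq_right hu, Real.zero_rpow (by norm_num), zero_mul]

theorem abs_chirp_le (u : ℝ) : |chirp u| ≤ (max u 0) ^ (1 / 4 : ℝ) := by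
  have h : 0 ≤ (max u 0) ^ (1 / 4 : ℝ) := Real.rpow_nonneg (le_max_right _ _) _
  rw [chirp, abs_mul, abs_of_nonneg h]
  exact mul_le_of_le_one_right h (Real.abs_sin_le_one _)

theorem continuous_max_rpow : Continuous fun u : ℝ => (max u 0) ^ (1 / 4 : ℝ) :=
  (continuous_id.max continuous_const).rpow_const fun _ => Or.inr (by norm_num)

theorem chirp_eventuallyEq {u : ℝ} (hu : 0 < u) :
    chirp =ᶠ[𝓝 u] fun v => v ^ (1 / 4 : ℝ) * Real.sin (v ^ (-(7 / 4) : ℝ)) := by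
  filter_upwards [eventually_gt_nhds hu] with v hv using chirp_of_nonneg hv.le

theorem differentiableAt_chirp {u : ℝ} (hu : 0 < u) : DifferentiableAt ℝ chirp u := by
  refine DifferentiableAt.congr_of_eventuallyEq ?_ (chirp_eventuallyEq hu)
  have h : ∀ p : ℝ, DifferentiableAt ℝ (fun v : ℝ => v ^ p) u := fun p =>
    Real.differentiableAt_rpow_const_of_ne p hu.ne'
  exact (h _).mul (h _).sin

theorem continuous_chirp : Continuous chirp := by
  refine continuous_iff_continuousAt.2 fun u => ?_
  rcases le_or_gt u 0 with hu | hu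
  · rw [ContinuousAt, chirp_of_nonpos hu]
    refine squeeze_zero_norm abs_chirp_le ?_
    have := continuous_max_rpow.tendsto u
    rwa [max_eq_right hu, Real.zero_rpow (by norm_num)] at this
  · exact (differentiableAt_chirp hu).continuousAt

theorem continuousOn_pow_mul_cos_rpow {k : ℕ} (hk : k ≠ 0) :
    ContinuousOn (fun u : ℝ => u ^ k * Real.cos (u ^ (-(7 / 4) : ℝ))) (Ici 0) := by
  intro u hu
  rcases (mem_Ici.1 hu).eq_or_lt with rfl | hu
  · have h0 : Tendsto (fun u : ℝ => |u| ^ k) (𝓝 0) (𝓝 0) := by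
      have : Continuous fun u : ℝ => |u| ^ k := by fun_prop
      simpa [hk] using this.tendsto 0
    refine ContinuousAt.continuousWithinAt ?_
    rw [ContinuousAt, zero_pow hk, zero_mul]
    refine squeeze_zero_norm (fun v => ?_) h0
    rw [norm_mul, norm_pow, Real.norm_eq_abs, Real.norm_eq_abs]
    exact mul_le_of_le_one_right (by positivity) (Real.abs_cos_le_one _)
  · refine ContinuousAt.continuousWithinAt ?_
    exact (continuousAt_id.pow k).mul (Real.continuous_cos.continuousAt.comp
      (Real.continuousAt_rpow_const u _ (Or.inl hu.ne')))

/-- Differentiating `(4/7) u^3 cos(u^(-7/4))` gives `chirp u`, because `3 - 7/4 - 1 = 1/4`, plus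
`(12/7) u^2 cos(u^(-7/4))`. The resulting constant `4/7 + 12/7` is below 3. -/
theorem abs_integral_chirp_le {h : ℝ} (hh : 0 ≤ h) : |∫ u in (0 : ℝ)..h, chirp u| ≤ 3 * h ^ 3 := by
  have hc := fun {k : ℕ} (hk : k ≠ 0) =>
    (continuousOn_pow_mul_cos_rpow hk).mono (Icc_subset_Ici_self : Icc 0 h ⊆ Ici 0)
  have hi2 : IntervalIntegrable (fun u : ℝ => 12 / 7 * (u ^ 2 * Real.cos (u ^ (-(7 / 4) : ℝ))))
      volume 0 h := ((hc two_ne_zero).intervalIntegrable_of_Icc hh).const_mul _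
  have hic := continuous_chirp.intervalIntegrable (μ := volume) 0 h
  have hderiv : ∀ u ∈ Ioo 0 h,
      HasDerivAt (fun u : ℝ => 4 / 7 * (u ^ 3 * Real.cos (u ^ (-(7 / 4) : ℝ))))
        (12 / 7 * (u ^ 2 * Real.cos (u ^ (-(7 / 4) : ℝ))) + chirp u) u := by
    intro u hu
    have hu0 : 0 < u := hu.1
    have h1 : HasDerivAt (fun v : ℝ => v ^ (-(7 / 4) : ℝ)) (-(7 / 4) * u ^ (-(7 / 4) - 1 : ℝ)) u :=
      Real.hasDerivAt_rpow_const (Or.inl hu0.ne')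
    refine (((hasDerivAt_pow 3 u).fun_mul h1.cos).const_mul (4 / 7)).congr_deriv ?_
    have h2 : u ^ 3 * u ^ (-(7 / 4) - 1 : ℝ) = u ^ (1 / 4 : ℝ) := by
      rw [← Real.rpow_natCast, ← Real.rpow_add hu0]
      norm_num
    rw [chirp_of_nonneg hu0.le, ← h2]
    push_cast
    ring
  have hftc := intervalIntegral.integral_eq_sub_of_hasDerivAt_of_le hh
    (continuousOn_const.mul (hc three_ne_zero)) hderiv (hi2.add hic)
  rw [intervalIntegral.integral_add hi2 hic] at hftc
  have hb : ‖∫ u in (0 : ℝ)..h, 12 / 7 * (u ^ 2 * Real.cos (u ^ (-(7 / 4) : ℝ)))‖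
      ≤ 12 / 7 * h ^ 2 * |h - 0| := by
    refine intervalIntegral.norm_integral_le_of_norm_le_const fun u hu => ?_
    rw [uIoc_of_le hh] at hu
    rw [norm_mul, norm_mul, norm_pow, Real.norm_eq_abs, Real.norm_eq_abs, Real.norm_eq_abs,
      abs_of_pos hu.1, abs_of_pos (show (0 : ℝ) < 12 / 7 by norm_num)]
    have h1 : u ^ 2 ≤ h ^ 2 := pow_le_pow_left₀ hu.1.le hu.2 2
    exact mul_le_mul_of_nonneg_left ((mul_le_of_le_one_right (by positivity)
      (Real.abs_cos_le_one _)).trans h1) (by norm_num)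
  rw [sub_zero, abs_of_nonneg hh, Real.norm_eq_abs, abs_le] at hb
  have hcos := abs_le.1 (Real.abs_cos_le_one (h ^ (-(7 / 4) : ℝ)))
  have h3 : 0 ≤ h ^ 3 := by positivity
  norm_num at hftc hb hcos
  rw [abs_le]
  constructor <;> nlinarith

theorem exists_chirp_eq {h : ℝ} (h0 : 0 < h) (h1 : h ≤ 1) {σ : ℝ} (hσ : σ = 1 ∨ σ = -1) :
    ∃ u ∈ Icc (h / 8) h, chirp u = σ * u ^ (1 / 4 : ℝ) := by
  set v₀ := h ^ (-(7 / 4) : ℝ) with hv₀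
  have hv₀1 : 1 ≤ v₀ := Real.one_le_rpow_of_pos_of_le_one_of_nonpos h0 h1 (by norm_num)
  -- `v` is the first phase at or after `v₀` whose sine is `σ`. As `v₀ ≥ 1`, `v < v₀ + 2π ≤ 8 v₀`,
  -- and `u = v^(-4/7)` loses at most a factor 8.
  set k : ℤ := ⌈(v₀ - σ * (Real.pi / 2)) / (2 * Real.pi)⌉ with hk
  set v := σ * (Real.pi / 2) + k * (2 * Real.pi) with hv
  have hpi := Real.pi_pos
  have hle := Int.le_ceil ((v₀ - σ * (Real.pi / 2)) / (2 * Real.pi))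
  have hlt := Int.ceil_lt_add_one ((v₀ - σ * (Real.pi / 2)) / (2 * Real.pi))
  rw [div_le_iff₀ (by positivity)] at hle
  rw [← sub_lt_iff_lt_add, lt_div_iff₀ (by positivity)] at hlt
  have hv1 : v₀ ≤ v := by linarith
  have hv8 : v ≤ 8 * v₀ := by linarith [Real.pi_lt_d2]
  have hvpos : 0 < v := by linarith
  have hsin : Real.sin v = σ := by
    rw [hv, Real.sin_add_int_mul_two_pi]
    rcases hσ with rfl | rfl
    · rw [one_mul, Real.sin_pi_div_two]
    · rw [neg_one_mul, Real.sin_neg, Real.sin_pi_div_two]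
  have hv₀pos : 0 < v₀ := by linarith
  have hinv : v₀ ^ (-(4 / 7) : ℝ) = h := by
    rw [hv₀, ← Real.rpow_mul h0.le]
    norm_num
  refine ⟨v ^ (-(4 / 7) : ℝ), ⟨?_, ?_⟩, ?_⟩
  · calc h / 8 = 8 ^ (-1 : ℝ) * v₀ ^ (-(4 / 7) : ℝ) := by
          rw [hinv, Real.rpow_neg_one]; ring
      _ ≤ 8 ^ (-(4 / 7) : ℝ) * v₀ ^ (-(4 / 7) : ℝ) := by
          gcongr
          · norm_num
          · norm_num
      _ = (8 * v₀) ^ (-(4 / 7) : ℝ) := (Real.mul_rpow (by norm_num) hv₀pos.le).symm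
      _ ≤ v ^ (-(4 / 7) : ℝ) := Real.rpow_le_rpow_of_nonpos hvpos hv8 (by norm_num)
  · rw [← hinv]
    exact Real.rpow_le_rpow_of_nonpos hv₀pos hv1 (by norm_num)
  · rw [chirp_of_nonneg (Real.rpow_nonneg hvpos.le _), ← Real.rpow_mul hvpos.le (-(4 / 7))
      (-(7 / 4))]
    norm_num
    rw [hsin, mul_comm]

/-! ### The bump on a single interval -/

/-- The continuous function that is `gapPiece α β` on `(α, β)` and `0` elsewhere. -/
noncomputable def gapBump (α β x : ℝ) : ℝ := chirp (min (x - α) (β - x))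

theorem continuous_gapBump (α β : ℝ) : Continuous (gapBump α β) :=
  continuous_chirp.comp (by fun_prop)

theorem gapPiece_eq_gapBump {α β x : ℝ} (hx : x ∈ Ioo α β) : gapPiece α β x = gapBump α β x := by
  unfold gapPiece gapBump
  split_ifs with h
  · rw [min_eq_left (by linarith), chirp_of_nonneg (by linarith [hx.1])]
  · rw [min_eq_right (by linarith), chirp_of_nonneg (by linarith [hx.2])]

theorem gapBump_of_le_left {α β x : ℝ} (hx : x ≤ α) : gapBump α β x = 0 :=
  chirp_of_nonpos ((min_le_left _ _).trans (by linarith))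

theorem gapBump_of_right_le {α β x : ℝ} (hx : β ≤ x) : gapBump α β x = 0 :=
  chirp_of_nonpos ((min_le_right _ _).trans (by linarith))

theorem gapBump_reflect (α β x : ℝ) : gapBump α β (α + β - x) = gapBump α β x := by
  unfold gapBump
  rw [min_comm]
  congr 2 <;> ring

/-- Past the midpoint the integral combines three chirp integrals, each over a length at most `y -
α`; hence 9 is three times 3. -/
theorem abs_integral_gapBump_left_le {α β y : ℝ} (hy : y ∈ Icc α β) :
    |∫ u in α..y, gapBump α β u| ≤ 9 * (y - α) ^ 3 := by
  have hhalf : ∀ z, α ≤ z → z ≤ (α + β) / 2 → |∫ u in α..z, gapBump α β u| ≤ 3 * (z - α) ^ 3 := by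
    intro z hz hz'
    have : ∫ u in α..z, gapBump α β u = ∫ u in α..z, chirp (u - α) := by
      refine intervalIntegral.integral_congr fun u hu => ?_
      rw [uIcc_of_le hz] at hu
      simp only [gapBump]
      rw [min_eq_left (by linarith [hu.2])]
    rw [this, intervalIntegral.integral_comp_sub_right, sub_self]
    exact abs_integral_chirp_le (by linarith)
  rcases le_total y ((α + β) / 2) with hm | hm
  · have h0 : 0 ≤ (y - α) ^ 3 := pow_nonneg (by linarith [hy.1]) 3
    linarith [hhalf y hy.1 hm]
  · set m := (α + β) / 2 with hm'
    have hαβ : α ≤ β := hy.1.trans hy.2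
    have hi := fun a b => (continuous_gapBump α β).intervalIntegrable (μ := volume) a b
    have h1 := hhalf m (by linarith) le_rfl
    have h2 : ∫ u in m..y, gapBump α β u
        = (∫ u in (0 : ℝ)..(β - m), chirp u) - ∫ u in (0 : ℝ)..(β - y), chirp u := by
      have : ∫ u in m..y, gapBump α β u = ∫ u in m..y, chirp (β - u) := by
        refine intervalIntegral.integral_congr fun u hu => ?_
        rw [uIcc_of_le hm] at hu
        simp only [gapBump]
        rw [min_eq_right (by linarith [hu.1])]
      rw [this, intervalIntegral.integral_comp_sub_left, intervalIntegral.integral_interval_sub_left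
        (continuous_chirp.intervalIntegrable _ _) (continuous_chirp.intervalIntegrable _ _)]
    have h3 := abs_integral_chirp_le (h := β - m) (by linarith)
    have h4 := abs_integral_chirp_le (h := β - y) (by linarith [hy.2])
    have h5 : (m - α) ^ 3 ≤ (y - α) ^ 3 := pow_le_pow_left₀ (by linarith) (by linarith) 3
    have h6 : (β - m) ^ 3 ≤ (y - α) ^ 3 := pow_le_pow_left₀ (by linarith) (by linarith) 3
    have h7 : (β - y) ^ 3 ≤ (y - α) ^ 3 :=
      pow_le_pow_left₀ (by linarith [hy.2]) (by linarith) 3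
    rw [← intervalIntegral.integral_add_adjacent_intervals (hi α m) (hi m y), h2]
    rw [abs_le] at h1 h3 h4 ⊢
    constructor <;> linarith

theorem abs_integral_gapBump_right_le {α β y : ℝ} (hy : y ∈ Icc α β) :
    |∫ u in y..β, gapBump α β u| ≤ 9 * (β - y) ^ 3 := by
  have h : ∫ u in y..β, gapBump α β u = ∫ u in α..(α + β - y), gapBump α β u := by
    have := intervalIntegral.integral_comp_sub_left (a := y) (b := β) (gapBump α β) (α + β)
    simp only [gapBump_reflect, add_sub_cancel_right] at this
    exact this
  rw [h]
  refine (abs_integral_gapBump_left_le ⟨by linarith [hy.2], by linarith [hy.1]⟩).trans_eq ?_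
  ring

theorem integral_gapBump_eq_zero_of_le {α β x y : ℝ} (hx : x ≤ α) (hy : y ≤ α) :
    ∫ u in x..y, gapBump α β u = 0 := by
  refine (intervalIntegral.integral_congr (g := fun _ => 0) fun u hu => ?_).trans (by simp)
  exact gapBump_of_le_left (hu.2.trans (max_le hx hy))

theorem integral_gapBump_eq_zero_of_ge {α β x y : ℝ} (hx : β ≤ x) (hy : β ≤ y) :
    ∫ u in x..y, gapBump α β u = 0 := by
  refine (intervalIntegral.integral_congr (g := fun _ => 0) fun u hu => ?_).trans (by simp)
  exact gapBump_of_right_le ((le_min hx hy).trans hu.1)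

theorem sub_le_measureReal_Ioo_inter_Ioc {α β x y u v : ℝ} (hαu : α ≤ u) (hxu : x ≤ u) (hvβ : v ≤ β)
    (hvy : v ≤ y) (huv : u ≤ v) : v - u ≤ volume.real (Ioo α β ∩ Ioc x y) := by
  rw [← Real.volume_real_Ioo_of_le huv]
  refine measureReal_mono (fun z hz => ?_) ?_
  · exact ⟨⟨hαu.trans_lt hz.1, hz.2.trans_le hvβ⟩, hxu.trans_lt hz.1, (hz.2.trans_le hvy).le⟩
  · exact ((measure_mono inter_subset_right).trans_lt measure_Ioc_lt_top).ne

/-- With an end of `[x, y]` outside the gap, any nontrivial overlap reaches an end of the gap, where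
the cubic bounds apply. The overlap is expressed as a measure so that it can be summed over gaps. -/
theorem abs_integral_gapBump_le {α β x y : ℝ} (hαβ : α ≤ β) (hxy : x ≤ y)
    (h : x ∉ Ioo α β ∨ y ∉ Ioo α β) :
    |∫ u in x..y, gapBump α β u| ≤ 9 * volume.real (Ioo α β ∩ Ioc x y) ^ 3 := by
  have hi := fun a b => (continuous_gapBump α β).intervalIntegrable (μ := volume) a b
  have hnonneg : 0 ≤ 9 * volume.real (Ioo α β ∩ Ioc x y) ^ 3 := by positivity
  rcases le_or_gt y α with hyα | hyα
  · rwa [integral_gapBump_eq_zero_of_le (hxy.trans hyα) hyα, abs_zero]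
  rcases le_or_gt β x with hxβ | hxβ
  · rwa [integral_gapBump_eq_zero_of_ge hxβ (hxβ.trans hxy), abs_zero]
  rcases le_or_gt x α with hxα | hxα
  · rw [← intervalIntegral.integral_add_adjacent_intervals (hi x α) (hi α y),
      integral_gapBump_eq_zero_of_le hxα le_rfl, zero_add]
    rcases le_total y β with hyβ | hyβ
    · refine (abs_integral_gapBump_left_le ⟨hyα.le, hyβ⟩).trans ?_
      have := sub_le_measureReal_Ioo_inter_Ioc le_rfl hxα hyβ le_rfl hyα.le
      have h0 : 0 ≤ y - α := by linarith
      gcongr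
    · rw [← intervalIntegral.integral_add_adjacent_intervals (hi α β) (hi β y),
        integral_gapBump_eq_zero_of_ge le_rfl hyβ, add_zero]
      refine (abs_integral_gapBump_left_le ⟨hαβ, le_rfl⟩).trans ?_
      have := sub_le_measureReal_Ioo_inter_Ioc le_rfl hxα le_rfl hyβ hαβ
      have h0 : 0 ≤ β - α := by linarith
      gcongr
  · have hyβ : β ≤ y := by
      rcases h with h | h
      · exact absurd ⟨hxα, hxβ⟩ h
      · exact not_lt.1 fun hy => h ⟨hyα, hy⟩
    rw [← intervalIntegral.integral_add_adjacent_intervals (hi x β) (hi β y),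
      integral_gapBump_eq_zero_of_ge le_rfl hyβ, add_zero]
    refine (abs_integral_gapBump_right_le ⟨hxα.le, hxβ.le⟩).trans ?_
    have := sub_le_measureReal_Ioo_inter_Ioc hxα.le le_rfl le_rfl hyβ hxβ.le
    have h0 : 0 ≤ β - x := by linarith
    gcongr

/-! ### Laplace derivatives from ordinary one-sided derivatives -/

theorem HasDerivWithinAt.hasRightLaplaceDeriv {F : ℝ → ℝ} {b x L : ℝ} (hF : Continuous F)
    (hx : x < b) (h : HasDerivWithinAt F L (Ioi x) x) : HasRightLaplaceDeriv F b L x := by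
  refine ⟨b - x, sub_pos.2 hx, by linarith, hF.intervalIntegrable _ _, ?_⟩
  refine tendsto_laplaceMean_of_tendsto_div (sub_pos.2 hx)
    (intervalIntegrable_right_increment (hF.intervalIntegrable _ _)) ?_
  have h1 := (hasDerivWithinAt_iff_tendsto_slope' self_notMem_Ioi).1 h
  have h2 : Tendsto (fun t : ℝ => x + t) (𝓝[>] 0) (𝓝[>] x) := by
    refine tendsto_nhdsWithin_iff.2 ⟨?_, ?_⟩
    · have : Continuous fun t : ℝ => x + t := by fun_prop
      simpa using (this.tendsto 0).mono_left nhdsWithin_le_nhds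
    · filter_upwards [self_mem_nhdsWithin] with t ht
      exact lt_add_of_pos_right x ht
  refine (h1.comp h2).congr fun t => ?_
  rw [Function.comp, slope_def_field, add_sub_cancel_left]

theorem HasDerivWithinAt.hasLeftLaplaceDeriv {F : ℝ → ℝ} {a x L : ℝ} (hF : Continuous F)
    (hx : a < x) (h : HasDerivWithinAt F L (Iio x) x) : HasLeftLaplaceDeriv F a L x := by
  refine ⟨x - a, sub_pos.2 hx, by linarith, hF.intervalIntegrable _ _, ?_⟩
  simp only [laplaceQuotLeft_eq_mean]
  refine tendsto_laplaceMean_of_tendsto_div (sub_pos.2 hx)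
    (intervalIntegrable_left_increment (hF.intervalIntegrable _ _)) ?_
  have h1 := (hasDerivWithinAt_iff_tendsto_slope' self_notMem_Iio).1 h
  have h2 : Tendsto (fun t : ℝ => x - t) (𝓝[>] 0) (𝓝[<] x) := by
    refine tendsto_nhdsWithin_iff.2 ⟨?_, ?_⟩
    · have : Continuous fun t : ℝ => x - t := by fun_prop
      simpa using (this.tendsto 0).mono_left nhdsWithin_le_nhds
    · filter_upwards [self_mem_nhdsWithin] with t ht
      exact sub_lt_self x ht
  refine (h1.comp h2).congr fun t => ?_
  rw [Function.comp, slope_def_field, sub_sub_cancel_left, div_neg, ← neg_div, neg_sub]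

/-! ### The function `svcFun` -/

theorem svcFun_of_mem_gap {p : ℝ × ℝ} (hp : p ∈ svcGaps) {x : ℝ} (hx : x ∈ Ioo p.1 p.2) :
    svcFun x = gapBump p.1 p.2 x := by
  have h : ∃ p ∈ svcGaps, x ∈ Ioo p.1 p.2 := ⟨p, hp, hx⟩
  rw [svcFun, dif_pos h, svcGaps_eq_of_mem h.choose_spec.1 hp h.choose_spec.2 hx,
    gapPiece_eq_gapBump hx]

theorem svcFun_of_forall_notMem {x : ℝ} (hx : ∀ p ∈ svcGaps, x ∉ Ioo p.1 p.2) : svcFun x = 0 := by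
  rw [svcFun, dif_neg]
  rintro ⟨p, hp, h⟩
  exact hx p hp h

theorem svcFun_eventuallyEq {p : ℝ × ℝ} (hp : p ∈ svcGaps) {x : ℝ} (hx : x ∈ Ioo p.1 p.2) :
    svcFun =ᶠ[𝓝 x] gapBump p.1 p.2 := by
  filter_upwards [isOpen_Ioo.mem_nhds hx] with y hy using svcFun_of_mem_gap hp hy

/-- Some end of the gap around `y` lies between `x` and `y`, so the argument of `chirp` is at most
`|y - x|`. -/
theorem abs_svcFun_le_of_forall_notMem {x : ℝ} (hx : ∀ p ∈ svcGaps, x ∉ Ioo p.1 p.2) (y : ℝ) :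
    |svcFun y| ≤ (max |y - x| 0) ^ (1 / 4 : ℝ) := by
  by_cases h : ∃ p ∈ svcGaps, y ∈ Ioo p.1 p.2
  · obtain ⟨p, hp, hy⟩ := h
    rw [svcFun_of_mem_gap hp hy]
    refine (abs_chirp_le _).trans ?_
    have : min (y - p.1) (p.2 - y) ≤ |y - x| := by
      rcases le_or_gt x p.1 with h1 | h1
      · exact (min_le_left _ _).trans ((by linarith : y - p.1 ≤ y - x).trans (le_abs_self _))
      · have h2 : p.2 ≤ x := not_lt.1 fun h2 => hx p hp ⟨h1, h2⟩
        exact (min_le_right _ _).trans ((by linarith : p.2 - y ≤ -(y - x)).trans (neg_le_abs _))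
    have h0 : (0 : ℝ) ≤ max (min (y - p.1) (p.2 - y)) 0 := le_max_right _ _
    gcongr
  · rw [svcFun_of_forall_notMem fun p hp hy => h ⟨p, hp, hy⟩, abs_zero]
    exact Real.rpow_nonneg (le_max_right _ _) _

theorem continuous_svcFun : Continuous svcFun := by
  refine continuous_iff_continuousAt.2 fun x => ?_
  by_cases h : ∃ p ∈ svcGaps, x ∈ Ioo p.1 p.2
  · obtain ⟨p, hp, hx⟩ := h
    exact (continuous_gapBump p.1 p.2).continuousAt.congr (svcFun_eventuallyEq hp hx).symm
  · have hx : ∀ p ∈ svcGaps, x ∉ Ioo p.1 p.2 := fun p hp hx => h ⟨p, hp, hx⟩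
    rw [ContinuousAt, svcFun_of_forall_notMem hx]
    refine squeeze_zero_norm (abs_svcFun_le_of_forall_notMem hx) ?_
    have hc : Continuous fun y : ℝ => (max |y - x| 0) ^ (1 / 4 : ℝ) :=
      continuous_max_rpow.comp (by fun_prop : Continuous fun y : ℝ => |y - x|)
    have := hc.tendsto x
    rwa [sub_self, abs_zero, max_self, Real.zero_rpow (by norm_num)] at this

theorem abs_integral_svcFun_le {x y : ℝ} (hxy : x ≤ y)
    (h : (∀ p ∈ svcGaps, x ∉ Ioo p.1 p.2) ∨ ∀ p ∈ svcGaps, y ∉ Ioo p.1 p.2) :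
    |∫ u in x..y, svcFun u| ≤ 9 * (y - x) ^ 3 := by
  have := countable_svcGaps.to_subtype
  set A : svcGaps → Set ℝ := fun p => Ioo p.1.1 p.1.2 ∩ Ioc x y with hA
  have hAm : ∀ p, MeasurableSet (A p) := fun p => measurableSet_Ioo.inter measurableSet_Ioc
  have hAd : Pairwise (Function.onFun Disjoint A) := by
    intro p q hpq
    refine Set.disjoint_left.2 fun z hz hz' => hpq (Subtype.ext ?_)
    exact svcGaps_eq_of_mem p.2 q.2 hz.1 hz'.1
  have hAsub : ⋃ p, A p ⊆ Ioc x y := iUnion_subset fun p => inter_subset_right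
  have hAfin : volume (⋃ p, A p) ≠ ⊤ := ((measure_mono hAsub).trans_lt measure_Ioc_lt_top).ne
  have hint : IntegrableOn svcFun (⋃ p, A p) :=
    ((continuous_svcFun.intervalIntegrable x y).1).mono_set hAsub
  have hsum := hasSum_integral_iUnion hAm hAd hint
  have hvol : HasSum (fun p => volume.real (A p)) (volume.real (⋃ p, A p)) := by
    have := hasSum_integral_iUnion hAm hAd (f := fun _ => (1 : ℝ))
      (integrableOn_const (C := (1 : ℝ)) hAfin)
    simpa using this
  have hvol_le : ∀ s ⊆ Ioc x y, volume.real s ≤ y - x := fun s hs => by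
    rw [← Real.volume_real_Ioc_of_le hxy]
    exact measureReal_mono hs measure_Ioc_lt_top.ne
  have htotal : ∫ u in x..y, svcFun u = ∫ u in ⋃ p, A p, svcFun u := by
    rw [intervalIntegral.integral_of_le hxy]
    refine setIntegral_eq_of_subset_of_forall_sdiff_eq_zero measurableSet_Ioc hAsub fun z hz => ?_
    exact svcFun_of_forall_notMem fun p hp hzp => hz.2 (mem_iUnion.2 ⟨⟨p, hp⟩, hzp, hz.1⟩)
  have hpiece : ∀ p : svcGaps, ∫ u in A p, svcFun u = ∫ u in x..y, gapBump p.1.1 p.1.2 u := by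
    intro p
    rw [intervalIntegral.integral_of_le hxy, setIntegral_congr_fun (hAm p)
      fun z hz => svcFun_of_mem_gap p.2 hz.1]
    refine (setIntegral_eq_of_subset_of_forall_sdiff_eq_zero measurableSet_Ioc inter_subset_right
      fun z hz => ?_).symm
    have : ¬(p.1.1 < z ∧ z < p.1.2) := fun hzp => hz.2 ⟨hzp, hz.1⟩
    rw [not_and_or, not_lt, not_lt] at this
    exact this.elim gapBump_of_le_left gapBump_of_right_le
  rw [htotal, ← hsum.tsum_eq, ← Real.norm_eq_abs]
  -- Two of the three factors in each cubed overlap are bounded by `y - x`; the remaining ones sum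
  -- to at most `y - x` by disjointness.
  refine (tsum_of_norm_bounded (hvol.mul_left (9 * (y - x) ^ 2)) fun p => ?_).trans ?_
  · rw [hpiece, Real.norm_eq_abs]
    refine (abs_integral_gapBump_le (svcGaps_lt p.2).le hxy (h.imp (· p p.2) (· p p.2))).trans ?_
    have h1 : volume.real (A p) ^ 2 ≤ (y - x) ^ 2 :=
      pow_le_pow_left₀ measureReal_nonneg (hvol_le _ inter_subset_right) 2
    change 9 * volume.real (A p) ^ 3 ≤ _
    rw [pow_succ _ 2, ← mul_assoc]
    exact mul_le_mul_of_nonneg_right (by linarith) measureReal_nonneg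
  · have := mul_le_mul_of_nonneg_left (hvol_le _ hAsub) (show 0 ≤ 9 * (y - x) ^ 2 by positivity)
    linarith

theorem hasLaplaceDeriv_svcFun_of_forall_notMem {x : ℝ} (hx : ∀ p ∈ svcGaps, x ∉ Ioo p.1 p.2) :
    HasLaplaceDeriv svcFun 0 1 0 x := by
  have hfx := svcFun_of_forall_notMem hx
  have hc := continuous_svcFun
  refine ⟨fun hx1 => ⟨1 - x, sub_pos.2 hx1, by linarith, hc.intervalIntegrable _ _, ?_⟩,
    fun hx0 => ⟨x - 0, sub_pos.2 hx0, by linarith, hc.intervalIntegrable _ _, ?_⟩⟩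
  · refine tendsto_laplaceMean_zero_of_primitive_le (C := 9) (sub_pos.2 hx1) (by fun_prop)
      fun t ht => ?_
    simp only [hfx, sub_zero]
    rw [intervalIntegral.integral_comp_add_left]
    refine (abs_integral_svcFun_le (by linarith [ht.1]) (Or.inl (by simpa using hx))).trans_eq ?_
    ring
  · simp only [laplaceQuotLeft_eq_mean]
    refine tendsto_laplaceMean_zero_of_primitive_le (C := 9) (sub_pos.2 hx0) (by fun_prop)
      fun t ht => ?_
    simp only [hfx, zero_sub]
    rw [intervalIntegral.integral_neg, abs_neg, intervalIntegral.integral_comp_sub_left]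
    refine (abs_integral_svcFun_le (by linarith [ht.1]) (Or.inr (by simpa using hx))).trans_eq ?_
    ring

theorem differentiableAt_chirp_sub {α x : ℝ} (hx : α < x) :
    DifferentiableAt ℝ (fun y => chirp (y - α)) x :=
  (differentiableAt_chirp (sub_pos.2 hx)).comp x (differentiableAt_id.sub_const α)

theorem differentiableAt_chirp_sub' {β x : ℝ} (hx : x < β) :
    DifferentiableAt ℝ (fun y => chirp (β - y)) x :=
  (differentiableAt_chirp (sub_pos.2 hx)).comp x (differentiableAt_id.const_sub β)

/-- The one-sided clause includes the midpoint, where only one-sided derivatives are claimed. -/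
theorem svcFun_eventuallyEq_left {p : ℝ × ℝ} (hp : p ∈ svcGaps) {x : ℝ} (hx : x ∈ Ioo p.1 p.2) :
    (x ≤ (p.1 + p.2) / 2 → ∀ᶠ y in 𝓝[≤] x, svcFun y = chirp (y - p.1)) ∧
      (x < (p.1 + p.2) / 2 → svcFun =ᶠ[𝓝 x] fun y => chirp (y - p.1)) := by
  refine ⟨fun hm => ?_, fun hm => ?_⟩
  · filter_upwards [self_mem_nhdsWithin, nhdsWithin_le_nhds (svcFun_eventuallyEq hp hx)] with y hy h
    rw [h, gapBump, min_eq_left (by linarith [mem_Iic.1 hy])]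
  · filter_upwards [eventually_lt_nhds hm, svcFun_eventuallyEq hp hx] with y hy h
    rw [h, gapBump, min_eq_left (by linarith)]

theorem svcFun_eventuallyEq_right {p : ℝ × ℝ} (hp : p ∈ svcGaps) {x : ℝ} (hx : x ∈ Ioo p.1 p.2) :
    ((p.1 + p.2) / 2 ≤ x → ∀ᶠ y in 𝓝[≥] x, svcFun y = chirp (p.2 - y)) ∧
      ((p.1 + p.2) / 2 < x → svcFun =ᶠ[𝓝 x] fun y => chirp (p.2 - y)) := by
  refine ⟨fun hm => ?_, fun hm => ?_⟩
  · filter_upwards [self_mem_nhdsWithin, nhdsWithin_le_nhds (svcFun_eventuallyEq hp hx)] with y hy h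
    rw [h, gapBump, min_eq_right (by linarith [mem_Ici.1 hy])]
  · filter_upwards [eventually_gt_nhds hm, svcFun_eventuallyEq hp hx] with y hy h
    rw [h, gapBump, min_eq_right (by linarith)]

theorem differentiableAt_svcFun {p : ℝ × ℝ} (hp : p ∈ svcGaps) {x : ℝ} (hx : x ∈ Ioo p.1 p.2)
    (hm : x ≠ (p.1 + p.2) / 2) : DifferentiableAt ℝ svcFun x := by
  rcases hm.lt_or_gt with hm | hm
  · exact (differentiableAt_chirp_sub hx.1).congr_of_eventuallyEq
      ((svcFun_eventuallyEq_left hp hx).2 hm)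
  · exact (differentiableAt_chirp_sub' hx.2).congr_of_eventuallyEq
      ((svcFun_eventuallyEq_right hp hx).2 hm)

theorem exists_hasRightLaplaceDeriv_svcFun {x : ℝ} (hx : x < 1) :
    ∃ L, HasRightLaplaceDeriv svcFun 1 L x := by
  by_cases h : ∃ p ∈ svcGaps, x ∈ Ioo p.1 p.2
  · obtain ⟨p, hp, hxp⟩ := h
    have : DifferentiableWithinAt ℝ svcFun (Ici x) x := by
      rcases lt_or_ge x ((p.1 + p.2) / 2) with hm | hm
      · exact (differentiableAt_svcFun hp hxp hm.ne).differentiableWithinAt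
      · exact (differentiableAt_chirp_sub' hxp.2).differentiableWithinAt.congr_of_eventuallyEq_of_mem
          ((svcFun_eventuallyEq_right hp hxp).1 hm) self_mem_Ici
    exact ⟨_, (this.hasDerivWithinAt.mono Ioi_subset_Ici_self).hasRightLaplaceDeriv
      continuous_svcFun hx⟩
  · exact ⟨0, (hasLaplaceDeriv_svcFun_of_forall_notMem fun p hp hxp => h ⟨p, hp, hxp⟩).1 hx⟩

theorem exists_hasLeftLaplaceDeriv_svcFun {x : ℝ} (hx : 0 < x) :
    ∃ L, HasLeftLaplaceDeriv svcFun 0 L x := by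
  by_cases h : ∃ p ∈ svcGaps, x ∈ Ioo p.1 p.2
  · obtain ⟨p, hp, hxp⟩ := h
    have : DifferentiableWithinAt ℝ svcFun (Iic x) x := by
      rcases lt_or_ge ((p.1 + p.2) / 2) x with hm | hm
      · exact (differentiableAt_svcFun hp hxp hm.ne').differentiableWithinAt
      · exact (differentiableAt_chirp_sub hxp.1).differentiableWithinAt.congr_of_eventuallyEq_of_mem
          ((svcFun_eventuallyEq_left hp hxp).1 hm) self_mem_Iic
    exact ⟨_, (this.hasDerivWithinAt.mono Iio_subset_Iic_self).hasLeftLaplaceDeriv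
      continuous_svcFun hx⟩
  · exact ⟨0, (hasLaplaceDeriv_svcFun_of_forall_notMem fun p hp hxp => h ⟨p, hp, hxp⟩).2 hx⟩

theorem exists_hasLaplaceDeriv_svcFun {x : ℝ} (hx : x ∉ svcMidpoints) :
    ∃ L, HasLaplaceDeriv svcFun 0 1 L x := by
  by_cases h : ∃ p ∈ svcGaps, x ∈ Ioo p.1 p.2
  · obtain ⟨p, hp, hxp⟩ := h
    have := (differentiableAt_svcFun hp hxp fun hm => hx ⟨p, hp, hm⟩).hasDerivAt
    exact ⟨_, fun h1 => this.hasDerivWithinAt.hasRightLaplaceDeriv continuous_svcFun h1,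
      fun h0 => this.hasDerivWithinAt.hasLeftLaplaceDeriv continuous_svcFun h0⟩
  · exact ⟨0, hasLaplaceDeriv_svcFun_of_forall_notMem fun p hp hxp => h ⟨p, hp, hxp⟩⟩

/-! ### Failure of differentiability and of Perron integrability -/

/-- At the points of the Cantor set the difference quotients of `svcFun` are unbounded below. -/
theorem frequently_svcFun_quotient_lt {x : ℝ} (hx : x ∈ SVC4) (M : ℝ) :
    ∃ᶠ y in 𝓝[Icc 0 1 \ {x}] x, (svcFun y - svcFun x) / (y - x) < M := by
  have hgap : ∀ p ∈ svcGaps, x ∉ Ioo p.1 p.2 := fun p hp => notMem_Ioo_of_mem_SVC4 hx hp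
  rw [svcFun_of_forall_notMem hgap]
  intro hev
  simp only [not_lt, sub_zero] at hev
  rw [eventually_nhdsWithin_iff, Metric.eventually_nhds_iff] at hev
  obtain ⟨ε, hε, hev⟩ := hev
  have h1 : ∀ᶠ n : ℕ in atTop, (1 / 2 : ℝ) ^ n < ε :=
    (tendsto_pow_atTop_nhds_zero_of_lt_one (by norm_num) (by norm_num)).eventually_lt_const hε
  -- Here `u ≥ h/8 = 4^(-n)/64`, while quotients bounded by `|M|` would force `u ≤ |M|^4 16^(-n)`;
  -- this threshold excludes both.
  have h2 : ∀ᶠ n : ℕ in atTop, 64 * |M| ^ 4 < (4 : ℝ) ^ n :=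
    (tendsto_pow_atTop_atTop_of_one_lt (by norm_num)).eventually_gt_atTop _
  obtain ⟨n, hnε, hnM⟩ := (h1.and h2).exists
  obtain ⟨p, hp, hlen, hdist⟩ := exists_svcGap_near hx n
  set h := (p.2 - p.1) / 2 with hh
  have hpos : (0 : ℝ) < (1 / 4) ^ (n + 1) := by positivity
  have hle1 : (1 / 4 : ℝ) ^ (n + 1) ≤ 1 := pow_le_one₀ (by norm_num) (by norm_num)
  have hh0 : 0 < h := by linarith
  have key : ∀ u ∈ Icc (h / 8) h, u ^ (1 / 4 : ℝ) ≤ |M| * |p.1 + u - x| → False := by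
    intro u hu hle
    have hu0 : 0 < u := by linarith [hu.1]
    have hd := hdist (p.1 + u) ⟨by linarith, by linarith [hu.2]⟩
    have h3 : u ^ (1 / 4 : ℝ) ≤ |M| * (1 / 2) ^ n := hle.trans (by gcongr)
    have h4 := pow_le_pow_left₀ (Real.rpow_nonneg hu0.le _) h3 4
    rw [← Real.rpow_natCast, ← Real.rpow_mul hu0.le] at h4
    norm_num [mul_pow] at h4
    have h5 : ((1 / 2 : ℝ) ^ n) ^ 4 = (1 / 4) ^ n * (1 / 4) ^ n := by
      rw [← pow_mul, mul_comm, pow_mul, ← mul_pow]; norm_num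
    rw [h5] at h4
    have h6 : (1 / 4 : ℝ) ^ n * 4 ^ n = 1 := by rw [← mul_pow]; norm_num
    have h7 : (0 : ℝ) < (1 / 4) ^ n := by positivity
    have h8 : h = (1 / 4) ^ n / 8 := by rw [hh, hlen, pow_succ]; ring
    have h9 := mul_lt_mul_of_pos_right hnM (mul_pos h7 h7)
    have h10 : (4 : ℝ) ^ n * ((1 / 4) ^ n * (1 / 4) ^ n) = (1 / 4) ^ n := by
      linear_combination (1 / 4 : ℝ) ^ n * h6
    linarith [hu.1]
  have hval : ∀ u ∈ Icc (h / 8) h, svcFun (p.1 + u) = chirp u ∧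
      M ≤ chirp u / (p.1 + u - x) ∧ p.1 + u ∈ Ioo p.1 p.2 := by
    intro u hu
    have hmem : p.1 + u ∈ Ioo p.1 p.2 := ⟨by linarith [hu.1], by linarith [hu.2]⟩
    have hf : svcFun (p.1 + u) = chirp u := by
      rw [svcFun_of_mem_gap hp hmem, gapBump, min_eq_left (by linarith [hu.2]),
        add_sub_cancel_left]
    refine ⟨hf, ?_, hmem⟩
    rw [← hf]
    refine hev ((hdist _ hmem).trans_lt hnε) ⟨svcGaps_Ioo_subset hp hmem, fun heq => ?_⟩
    exact hgap p hp (mem_singleton_iff.1 heq ▸ hmem)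
  -- The sign of the extremum is opposite to the side of the gap, so the quotient is negative in
  -- both cases.
  rcases le_or_gt x p.1 with hxp | hxp
  · obtain ⟨u, hu, hcu⟩ := exists_chirp_eq hh0 (by linarith) (Or.inr rfl)
    obtain ⟨-, hM, hmem⟩ := hval u hu
    have hpos : 0 < p.1 + u - x := by linarith [hmem.1]
    rw [hcu, le_div_iff₀ hpos] at hM
    refine key u hu ?_
    rw [abs_of_pos hpos]
    nlinarith [neg_abs_le M]
  · have hxp2 : p.2 ≤ x := not_lt.1 fun h2 => hgap p hp ⟨hxp, h2⟩
    obtain ⟨u, hu, hcu⟩ := exists_chirp_eq hh0 (by linarith) (Or.inl rfl)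
    obtain ⟨-, hM, hmem⟩ := hval u hu
    have hneg : p.1 + u - x < 0 := by linarith [hmem.2]
    rw [hcu, le_div_iff_of_neg hneg] at hM
    refine key u hu ?_
    rw [abs_of_neg hneg]
    nlinarith [neg_abs_le M]

theorem not_differentiableWithinAt_svcFun {x : ℝ} (hx : x ∈ SVC4) :
    ¬ DifferentiableWithinAt ℝ svcFun (Icc (0 : ℝ) 1) x := by
  intro hd
  have h := hasDerivWithinAt_iff_tendsto_slope.1 hd.hasDerivWithinAt
  refine frequently_svcFun_quotient_lt hx (derivWithin svcFun (Icc 0 1) x - 1) ?_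
  filter_upwards [h.eventually_const_lt (sub_one_lt _)] with y hy
  rw [slope_def_field] at hy
  exact hy.le.not_gt

theorem isLaplacePrimitive_svcFun {φ : ℝ → ℝ}
    (h : ∀ x ∈ Icc (0 : ℝ) 1 \ svcMidpoints, HasLaplaceDeriv svcFun 0 1 (φ x) x) :
    IsLaplacePrimitive svcFun φ svcMidpoints 0 1 where
  continuousOn := continuous_svcFun.continuousOn
  hasLaplaceDeriv := h
  right _ hx := exists_hasRightLaplaceDeriv_svcFun hx.2
  left _ hx := exists_hasLeftLaplaceDeriv_svcFun hx.1

/-- Without major functions the infimum would be `⊤`, which is not a real number. -/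
theorem PerronIntegrable.exists_major {f : ℝ → ℝ} {a b : ℝ} (h : PerronIntegrable f a b) :
    ∃ U, IsPerronMajor f a b U := by
  obtain ⟨I, -, hI⟩ := h
  by_contra! hcon
  have : {r : EReal | ∃ U, IsPerronMajor f a b U ∧ r = ((U b - U a : ℝ) : EReal)} = ∅ :=
    eq_empty_of_forall_notMem fun r ⟨U, hU, _⟩ => hcon U hU
  rw [this, sInf_empty] at hI
  exact EReal.coe_ne_top I hI.symm

theorem not_perronIntegrable_of_hasLaplaceDeriv_svcFun {φ : ℝ → ℝ}
    (h : ∀ x ∈ Icc (0 : ℝ) 1 \ svcMidpoints, HasLaplaceDeriv svcFun 0 1 (φ x) x) :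
    ¬ PerronIntegrable φ 0 1 := by
  intro hφ
  obtain ⟨U, hU⟩ := hφ.exists_major
  have hae := (ae_restrict_iff' measurableSet_Icc).1
    ((isLaplacePrimitive_svcFun h).ae_eventually_quotient_ge countable_svcMidpoints hU)
  refine volume_SVC4_pos.ne' (measure_mono_null (fun x hx => ?_) (ae_iff.1 hae))
  intro hgood
  obtain ⟨M, hM⟩ := hgood (SVC4_subset_Icc hx)
  exact frequently_svcFun_quotient_lt hx M (hM.mono fun y hy => hy.le.not_gt)

theorem mainTheorem1 :
    -- `f` is continuous on `[0, 1]`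
    ContinuousOn svcFun (Icc (0 : ℝ) 1) ∧
    -- both one-sided Laplace derivatives of `f` exist finitely at every point
    (∀ x ∈ Ico (0 : ℝ) 1, ∃ L : ℝ, HasRightLaplaceDeriv svcFun 1 L x) ∧
    (∀ x ∈ Ioc (0 : ℝ) 1, ∃ L : ℝ, HasLeftLaplaceDeriv svcFun 0 L x) ∧
    -- `f` is Laplace differentiable at every point that is not the midpoint of a gap
    (∀ x ∈ Icc (0 : ℝ) 1 \ svcMidpoints, ∃ L : ℝ, HasLaplaceDeriv svcFun 0 1 L x) ∧
    -- `f` is differentiable at no point of SVC(4)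
    (∀ x ∈ SVC4, ¬ DifferentiableWithinAt ℝ svcFun (Icc (0 : ℝ) 1) x) ∧
    -- `LD₁ f`, with arbitrary values at the midpoints, is Laplace but not Perron integrable
    (∀ φ : ℝ → ℝ,
      (∀ x ∈ Icc (0 : ℝ) 1 \ svcMidpoints, HasLaplaceDeriv svcFun 0 1 (φ x) x) →
        LaplaceIntegrable φ 0 1 ∧ ¬ PerronIntegrable φ 0 1) ∧
    -- the Laplace integral contains the Perron integral, with the same value, ...
    (∀ a b : ℝ, a < b → ∀ (g : ℝ → ℝ) (I : ℝ),
      HasPerronIntegral g a b I → HasLaplaceIntegral g a b I) ∧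
    -- ... and strictly so
    {g : ℝ → ℝ | PerronIntegrable g 0 1} ⊂ {g : ℝ → ℝ | LaplaceIntegrable g 0 1} := by
  have hLP : ∀ φ : ℝ → ℝ,
      (∀ x ∈ Icc (0 : ℝ) 1 \ svcMidpoints, HasLaplaceDeriv svcFun 0 1 (φ x) x) →
        LaplaceIntegrable φ 0 1 ∧ ¬ PerronIntegrable φ 0 1 := fun φ hφ =>
    ⟨⟨_, (isLaplacePrimitive_svcFun hφ).hasLaplaceIntegral countable_svcMidpoints zero_le_one⟩,
      not_perronIntegrable_of_hasLaplaceDeriv_svcFun hφ⟩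
  refine ⟨continuous_svcFun.continuousOn, fun x hx => exists_hasRightLaplaceDeriv_svcFun hx.2,
    fun x hx => exists_hasLeftLaplaceDeriv_svcFun hx.1,
    fun x hx => exists_hasLaplaceDeriv_svcFun hx.2,
    fun x hx => not_differentiableWithinAt_svcFun hx, hLP,
    fun a b hab g I h => h.hasLaplaceIntegral hab.le, ?_⟩
  refine ⟨fun g ⟨I, hI⟩ => ⟨I, hI.hasLaplaceIntegral zero_le_one⟩, fun hsub => ?_⟩
  -- Strictness is witnessed by the Laplace derivative itself, with whatever values the choice gives
  -- at midpoints.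
  choose! φ hφ using fun (x : ℝ) (hx : x ∉ svcMidpoints) => exists_hasLaplaceDeriv_svcFun hx
  obtain ⟨h1, h2⟩ := hLP φ fun x hx => hφ x hx.2
  exact h2 (hsub h1)
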